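/- Write $\mathbb N=\{1,2,\dots\}$ and $a\vee b=\max(a,b)$. For finite sets $F,G\subset\mathbb N$ let $F<G$ mean that every element of $F$ is smaller than every element of $G$. The Schreier families are $S_0=\{\emptyset\}\cup\{\{n\}:n\in\mathbb N\}$ and $$S_{k+1}=\Big\{\bigcup_{i=1}^nF_i:\ n\in\mathbb N,\ F_1<\dots<F_n\text{ in }S_k,\ n\le \min F_i\text{ for every }i\text{ with }F_i\neq\emptyset\Big\},$$ where $F_i<F_j$ is required for all $i<j$. A finite sequence $E_1<\dots<E_n$ of non-empty subsets of $\mathbb N$ is $k$-admissible if $\{\min E_1,\dots,\min E_n\}\in S_k$. A sequence $(\theta_n)_{n\in\mathbb N}\subset(0,1)$ is regular if it is non-increasing, $\theta_n\to0$ and $\theta_{n+m}\ge\theta_n\theta_m$ for all $n,m\in\mathbb N$. For such a sequence the limit $\theta=\lim_n\theta_n^{1/n}$ exists; put $\varphi_n=\theta_n/\theta^n$. The (regular) mixed Tsirelson space $X=T(\theta_n,S_n)_{n\in\mathbb N}$ is the completion of $c_{00}$ under the norm determined by $$\|x\|=\|x\|_\infty\vee\sup_{q\in\mathbb N}\sup\Big\{\theta_q\sum_{i=1}^n\|E_ix\|:\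 (E_i)_{i=1}^n\text{ is }q\text{-admissible}\Big\},$$ where $E_ix$ is the restriction of $x$ to $E_i$; $(e_i)$ is its unit vector basis. Let $Y\prec X$, i.e. $Y$ is a subspace of $X$ with a basis $(y_i)_{i\in\mathbb N}$ consisting of non-zero, successively supported, finite linear combinations of the $e_k$. For $j\in\mathbb N$ let $\delta_j(Y)$ be the supremum of all $\delta\ge0$ such that $\|\sum_{i=1}^nz_i\|\ge\delta\sum_{i=1}^n\|z_i\|$ for every finite block sequence $(z_i)_{i=1}^n$ of $(y_i)$ whose ranges with respect to $(y_i)$ form a $j$-admissible sequence. **Theorem.** Let $X=T(\theta_n,S_n)_{n\in\mathbb N}$ be regular. Then for all $Y\prec X$ and all $j\in\mathbb N$, $$\delta_j(Y)\ \le\ \Big(\theta^j\,\sup_{p\ge j}\varphi_p\Big)\ \vee\ \frac{\theta_j}{\theta_1}.$$ -/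

import Mathlib

open Filter Topology
open scoped ENNReal

namespace MixedTsirelson

/-- A sequence `(θ_n)_{n ≥ 1}` of scalars is regular: it lies in `(0,1)`, decreases to `0`, and
`θ_{n+m} ≥ θ_n θ_m`. -/
structure IsRegular (θ : ℕ+ → ℝ) : Prop where
  pos : ∀ n, 0 < θ n
  lt_one : ∀ n, θ n < 1
  antitone : Antitone θ
  tendsto_zero : Tendsto θ atTop (𝓝 0)
  mul_le : ∀ n m, θ n * θ m ≤ θ (n + m)

/-- The limit `lim_n θ_n^{1/n}`. -/
noncomputable def rootLim (θ : ℕ+ → ℝ) : ℝ :=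
  limUnder atTop (fun n : ℕ+ => θ n ^ (1 / (n : ℝ)))

/-- `φ_n = θ_n / θ^n`, where `θ = lim_n θ_n^{1/n}`. -/
noncomputable def phi (θ : ℕ+ → ℝ) (n : ℕ+) : ℝ := θ n / rootLim θ ^ (n : ℕ)

/-- The Schreier families `S_0, S_1, S_2, …` of finite subsets of `{1, 2, …}`. -/
def Schreier : ℕ → Set (Finset ℕ+)
  | 0 => {F | F.card ≤ 1}
  | α + 1 => {F | ∃ (n : ℕ+) (G : Fin n → Finset ℕ+),
      (∀ i, G i ∈ Schreier α) ∧
      (∀ i, ∀ k ∈ G i, n ≤ k) ∧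
      (∀ i j, i < j → ∀ a ∈ G i, ∀ b ∈ G j, a < b) ∧
      F = Finset.univ.biUnion G}

/-- A finite sequence `E_1 < ⋯ < E_n` of non-empty sets is `α`-admissible if
`{min E_1, …, min E_n} ∈ S_α`. -/
def Admissible (α : ℕ) {n : ℕ} (E : Fin n → Set ℕ+) : Prop :=
  (∀ i j, i < j → ∀ a ∈ E i, ∀ b ∈ E j, a < b) ∧
  ∃ m : Fin n → ℕ+, (∀ i, IsLeast (E i) (m i)) ∧ Finset.univ.image m ∈ Schreier α

/-- The restriction `Ex` of `x ∈ c_00` to the set `E`. -/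
noncomputable def restrict (E : Set ℕ+) (x : ℕ+ →₀ ℝ) : ℕ+ →₀ ℝ :=
  open Classical in x.filter (· ∈ E)

/-- The range of `x ∈ c_00`: the smallest interval containing the support of `x`. -/
def ran (x : ℕ+ →₀ ℝ) : Set ℕ+ :=
  {k | ∃ a ∈ x.support, ∃ b ∈ x.support, a ≤ k ∧ k ≤ b}

/-! ### The mixed Tsirelson norm -/

/-- The right-hand side of the implicit equation of the mixed Tsirelson norm, for a
given function `N` on `c_00`:
`‖x‖_∞ ∨ sup_q sup {θ_q ∑_i N (E_i x) : (E_i) is q-admissible}`. -/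
noncomputable def step (θ : ℕ+ → ℝ) (N : (ℕ+ →₀ ℝ) → ℝ≥0∞) (x : ℕ+ →₀ ℝ) : ℝ≥0∞ :=
  (⨆ k, ‖x k‖ₑ) ⊔
    ⨆ (q : ℕ+) (n : ℕ) (E : Fin n → Set ℕ+) (_ : Admissible q E),
      ENNReal.ofReal (θ q) * ∑ i, N (restrict (E i) x)

/-- The approximations of the mixed Tsirelson norm: iterate `step`, starting from `0`. -/
noncomputable def approx (θ : ℕ+ → ℝ) : ℕ → (ℕ+ →₀ ℝ) → ℝ≥0∞
  | 0 => fun _ => 0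
  | m + 1 => step θ (approx θ m)

/-- The mixed Tsirelson norm of `T(θ_n, S_n)` on `c_00`, as an extended non-negative number. -/
noncomputable def eNorm (θ : ℕ+ → ℝ) (x : ℕ+ →₀ ℝ) : ℝ≥0∞ := ⨆ m, approx θ m x

theorem le_step (θ : ℕ+ → ℝ) (N : (ℕ+ →₀ ℝ) → ℝ≥0∞) (x : ℕ+ →₀ ℝ) (q : ℕ+) {n : ℕ}
    (E : Fin n → Set ℕ+) (hE : Admissible q E) :
    ENNReal.ofReal (θ q) * ∑ i, N (restrict (E i) x) ≤ step θ N x :=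
  le_sup_of_le_right
    (le_iSup_of_le q (le_iSup_of_le n (le_iSup_of_le E (le_iSup_of_le hE le_rfl))))

theorem step_mono (θ : ℕ+ → ℝ) {N N' : (ℕ+ →₀ ℝ) → ℝ≥0∞} (h : ∀ x, N x ≤ N' x)
    (x : ℕ+ →₀ ℝ) : step θ N x ≤ step θ N' x := by
  unfold step
  gcongr
  exact h _

theorem approx_mono (θ : ℕ+ → ℝ) (x : ℕ+ →₀ ℝ) : Monotone (fun m => approx θ m x) := by
  have key : ∀ m x, approx θ m x ≤ approx θ (m + 1) x := by
    intro m
    induction m with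
    | zero => intro x; exact zero_le
    | succ m ih => intro x; exact step_mono θ ih x
  exact monotone_nat_of_le_succ fun m => key m x

/-- The mixed Tsirelson norm satisfies its implicit equation. -/
theorem eNorm_eq (θ : ℕ+ → ℝ) (x : ℕ+ →₀ ℝ) : eNorm θ x = step θ (eNorm θ) x := by
  apply le_antisymm
  · refine iSup_le fun m => ?_
    cases m with
    | zero => exact zero_le
    | succ m => exact step_mono θ (fun y => le_iSup (fun m => approx θ m y) m) x
  · refine sup_le ?_ ?_
    · exact le_trans le_sup_left (le_iSup (fun m => approx θ m x) 1)
    · refine iSup_le fun q => iSup_le fun n => iSup_le fun E => iSup_le fun hE => ?_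
      simp only [eNorm]
      rw [ENNReal.finsetSum_iSup_of_monotone (fun i => approx_mono θ _), ENNReal.mul_iSup]
      refine iSup_le fun m => ?_
      exact (le_step θ (approx θ m) x q E hE).trans (le_iSup (fun m => approx θ m x) (m + 1))

theorem restrict_add (E : Set ℕ+) (x y : ℕ+ →₀ ℝ) :
    restrict E (x + y) = restrict E x + restrict E y := by
  classical
  exact Finsupp.filter_add

theorem restrict_smul (E : Set ℕ+) (c : ℝ) (x : ℕ+ →₀ ℝ) :
    restrict E (c • x) = c • restrict E x := by
  classical
  exact Finsupp.filter_smul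

theorem approx_add (θ : ℕ+ → ℝ) (m : ℕ) (x y : ℕ+ →₀ ℝ) :
    approx θ m (x + y) ≤ approx θ m x + approx θ m y := by
  induction m generalizing x y with
  | zero => exact zero_le
  | succ m ih =>
    refine sup_le ?_ ?_
    · refine iSup_le fun k => ?_
      refine le_trans (enorm_add_le (x k) (y k)) ?_
      gcongr
      · exact le_trans (le_iSup (fun k => ‖x k‖ₑ) k) le_sup_left
      · exact le_trans (le_iSup (fun k => ‖y k‖ₑ) k) le_sup_left
    · refine iSup_le fun q => iSup_le fun n => iSup_le fun E => iSup_le fun hE => ?_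
      have h1 : ∀ z, ENNReal.ofReal (θ q) * ∑ i, approx θ m (restrict (E i) z)
          ≤ approx θ (m + 1) z := fun z => le_step θ (approx θ m) z q E hE
      refine le_trans ?_ (add_le_add (h1 x) (h1 y))
      rw [← mul_add, ← Finset.sum_add_distrib]
      gcongr with i
      rw [restrict_add]
      exact ih _ _

theorem approx_smul_le (θ : ℕ+ → ℝ) (m : ℕ) (c : ℝ) (x : ℕ+ →₀ ℝ) :
    approx θ m (c • x) ≤ ‖c‖ₑ * approx θ m x := by
  induction m generalizing x with
  | zero => exact zero_le
  | succ m ih =>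
    refine sup_le ?_ ?_
    · refine iSup_le fun k => ?_
      rw [Finsupp.smul_apply, smul_eq_mul, enorm_mul]
      gcongr
      exact le_trans (le_iSup (fun k => ‖x k‖ₑ) k) le_sup_left
    · refine iSup_le fun q => iSup_le fun n => iSup_le fun E => iSup_le fun hE => ?_
      have h1 : ENNReal.ofReal (θ q) * ∑ i, approx θ m (restrict (E i) x)
          ≤ approx θ (m + 1) x := le_step θ (approx θ m) x q E hE
      refine le_trans ?_ (mul_le_mul_right h1 _)
      rw [mul_left_comm ‖c‖ₑ, Finset.mul_sum Finset.univ _ ‖c‖ₑ]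
      gcongr with i
      rw [restrict_smul]
      exact ih _

theorem approx_single_le {θ : ℕ+ → ℝ} (h : IsRegular θ) (m : ℕ) (k : ℕ+) (r : ℝ) :
    approx θ m (Finsupp.single k r) ≤ ‖r‖ₑ := by
  classical
  have h0 : ∀ m, approx θ m (0 : ℕ+ →₀ ℝ) = 0 := fun m => by
    have := approx_smul_le θ m 0 (0 : ℕ+ →₀ ℝ)
    simpa using this
  induction m with
  | zero => exact zero_le
  | succ m ih =>
    refine sup_le ?_ ?_
    · refine iSup_le fun l => ?_
      by_cases hl : k = l
      · subst hl; simp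
      · simp [hl]
    · refine iSup_le fun q => iSup_le fun n => iSup_le fun E => iSup_le fun hE => ?_
      have hr : ∀ i, restrict (E i) (Finsupp.single k r) =
          if k ∈ E i then Finsupp.single k r else 0 := by
        intro i
        unfold restrict
        split_ifs with hk
        · convert Finsupp.filter_single_of_pos (· ∈ E i) hk
        · convert Finsupp.filter_single_of_neg (· ∈ E i) hk
      have hsum : ∑ i, approx θ m (restrict (E i) (Finsupp.single k r)) ≤ ‖r‖ₑ := by
        by_cases hex : ∃ i, k ∈ E i
        · obtain ⟨i, hi⟩ := hex
          rw [Finset.sum_eq_single i]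
          · rw [hr, if_pos hi]; exact ih
          · intro j _ hj
            rw [hr, if_neg, h0]
            intro hkj
            rcases lt_or_gt_of_ne hj with hlt | hlt
            · exact lt_irrefl _ (hE.1 _ _ hlt _ hkj _ hi)
            · exact lt_irrefl _ (hE.1 _ _ hlt _ hi _ hkj)
          · simp
        · push Not at hex
          rw [Finset.sum_eq_zero]
          · exact zero_le
          · intro i _
            rw [hr, if_neg (hex i), h0]
      calc _ ≤ 1 * ‖r‖ₑ := by
            gcongr
            exact ENNReal.ofReal_le_one.2 (h.lt_one q).le
        _ = _ := one_mul _

theorem eNorm_single_le {θ : ℕ+ → ℝ} (h : IsRegular θ) (k : ℕ+) (r : ℝ) :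
    eNorm θ (Finsupp.single k r) ≤ ‖r‖ₑ :=
  iSup_le fun m => approx_single_le h m k r

theorem eNorm_add_le (θ : ℕ+ → ℝ) (x y : ℕ+ →₀ ℝ) :
    eNorm θ (x + y) ≤ eNorm θ x + eNorm θ y :=
  iSup_le fun m => (approx_add θ m x y).trans
    (add_le_add (le_iSup (fun m => approx θ m x) m) (le_iSup (fun m => approx θ m y) m))

theorem eNorm_smul_le (θ : ℕ+ → ℝ) (c : ℝ) (x : ℕ+ →₀ ℝ) :
    eNorm θ (c • x) ≤ ‖c‖ₑ * eNorm θ x :=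
  iSup_le fun m => (approx_smul_le θ m c x).trans
    (mul_le_mul_right (le_iSup (fun m => approx θ m x) m) _)

theorem eNorm_smul (θ : ℕ+ → ℝ) (c : ℝ) (x : ℕ+ →₀ ℝ) :
    eNorm θ (c • x) = ‖c‖ₑ * eNorm θ x := by
  refine le_antisymm (eNorm_smul_le θ c x) ?_
  by_cases hc : c = 0
  · simp [hc]
  · have h1 := eNorm_smul_le θ c⁻¹ (c • x)
    rw [smul_smul, inv_mul_cancel₀ hc, one_smul] at h1
    calc ‖c‖ₑ * eNorm θ x ≤ ‖c‖ₑ * (‖c⁻¹‖ₑ * eNorm θ (c • x)) := by gcongr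
      _ = eNorm θ (c • x) := by
        rw [← mul_assoc, ← enorm_mul, mul_inv_cancel₀ hc]; simp

theorem eNorm_ne_top {θ : ℕ+ → ℝ} (h : IsRegular θ) (x : ℕ+ →₀ ℝ) : eNorm θ x ≠ ⊤ := by
  induction x using Finsupp.induction_linear with
  | zero =>
    have := eNorm_smul_le θ 0 (0 : ℕ+ →₀ ℝ)
    simp only [smul_zero, enorm_zero, zero_mul] at this
    exact ne_top_of_le_ne_top ENNReal.zero_ne_top this
  | add x y hx hy => exact ne_top_of_le_ne_top (ENNReal.add_ne_top.2 ⟨hx, hy⟩) (eNorm_add_le θ x y)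
  | single k r => exact ne_top_of_le_ne_top enorm_ne_top (eNorm_single_le h k r)

theorem enorm_le_eNorm (θ : ℕ+ → ℝ) (x : ℕ+ →₀ ℝ) (k : ℕ+) : ‖x k‖ₑ ≤ eNorm θ x := by
  rw [eNorm_eq]
  exact le_trans (le_iSup (fun k => ‖x k‖ₑ) k) le_sup_left

/-! ### The space `T(θ_n, S_n)` -/

/-- The space `c_00` of finitely supported real sequences, to be equipped with the mixed
Tsirelson norm of `T(θ_n, S_n)`. -/
def C00 (θ : ℕ+ → ℝ) (_h : IsRegular θ) : Type := ℕ+ →₀ ℝ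

section C00

variable {θ : ℕ+ → ℝ} {h : IsRegular θ}

noncomputable instance : AddCommGroup (C00 θ h) := inferInstanceAs (AddCommGroup (ℕ+ →₀ ℝ))

noncomputable instance : Module ℝ (C00 θ h) := inferInstanceAs (Module ℝ (ℕ+ →₀ ℝ))

noncomputable instance : Norm (C00 θ h) := ⟨fun x => (eNorm θ x).toReal⟩

theorem C00.core : NormedSpace.Core ℝ (C00 θ h) where
  norm_nonneg _ := ENNReal.toReal_nonneg
  norm_smul c x := by
    change (eNorm θ (c • (show ℕ+ →₀ ℝ from x))).toReal = ‖c‖ * (eNorm θ x).toReal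
    rw [eNorm_smul, ENNReal.toReal_mul, toReal_enorm]
  norm_triangle x y := by
    have hx := eNorm_ne_top h x
    have hy := eNorm_ne_top h y
    change (eNorm θ ((show ℕ+ →₀ ℝ from x) + (show ℕ+ →₀ ℝ from y))).toReal
      ≤ (eNorm θ x).toReal + (eNorm θ y).toReal
    rw [← ENNReal.toReal_add hx hy]
    exact ENNReal.toReal_mono (ENNReal.add_ne_top.2 ⟨hx, hy⟩) (eNorm_add_le θ _ _)
  norm_eq_zero_iff x := by
    constructor
    · intro hx
      have h0 : eNorm θ x = 0 :=
        ((ENNReal.toReal_eq_zero_iff _).1 hx).resolve_right (eNorm_ne_top h x)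
      refine Finsupp.ext fun k => ?_
      have := enorm_le_eNorm θ x k
      rw [h0] at this
      exact enorm_eq_zero.1 (le_antisymm this zero_le)
    · rintro rfl
      have := eNorm_smul θ 0 (0 : ℕ+ →₀ ℝ)
      simp only [smul_zero, enorm_zero, zero_mul] at this
      change (eNorm θ (0 : ℕ+ →₀ ℝ)).toReal = 0
      rw [this]; rfl

noncomputable instance : NormedAddCommGroup (C00 θ h) := NormedAddCommGroup.ofCore C00.core

noncomputable instance : NormedSpace ℝ (C00 θ h) := NormedSpace.ofCore C00.core

end C00

/-- The mixed Tsirelson space `T(θ_n, S_n)_{n ∈ ℕ}`: the completion of `c_00` under the mixed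
Tsirelson norm. -/
abbrev Space (θ : ℕ+ → ℝ) (h : IsRegular θ) : Type := UniformSpace.Completion (C00 θ h)

/-- The unit vector basis `(e_k)` of `T(θ_n, S_n)`. -/
noncomputable def e (θ : ℕ+ → ℝ) (h : IsRegular θ) (k : ℕ+) : Space θ h :=
  ((show C00 θ h from Finsupp.single k (1 : ℝ)) : UniformSpace.Completion (C00 θ h))

/-! ### Block bases and the asymptotic constants `δ_α` -/

section Block

variable {V : Type*} [NormedAddCommGroup V] [NormedSpace ℝ V]

/-- `(y_i)` is a block basis of `(x_i)`: `y_i` is a linear combination of the `x_k` with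
coefficient sequence `c_i ∈ c_00`, where the `c_i` are non-zero and `c_1 < c_2 < ⋯`. -/
def IsBlockBasis (y x : ℕ+ → V) : Prop :=
  ∃ c : ℕ+ → (ℕ+ →₀ ℝ), (∀ i, c i ≠ 0) ∧
    (∀ i j, i < j → ∀ a ∈ ran (c i), ∀ b ∈ ran (c j), a < b) ∧
    ∀ i, y i = Finsupp.linearCombination ℝ x (c i)

/-- The constant `δ_α(x_i)`: the supremum of all `δ ≥ 0` such that
`‖∑ z_i‖ ≥ δ ∑ ‖z_i‖` for all finite block sequences `(z_i)_1^n` of `(x_i)` that are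
`α`-admissible with respect to `(x_i)`. The vector `z_i` is given by its coefficient sequence
`c_i` with respect to `(x_k)`; that the `c_i` are non-zero and successive is part of the
admissibility of their ranges. -/
noncomputable def delta (α : ℕ) (x : ℕ+ → V) : ℝ :=
  sSup {δ : ℝ | 0 ≤ δ ∧ ∀ (n : ℕ) (c : Fin n → (ℕ+ →₀ ℝ)), Admissible α (fun i => ran (c i)) →
    δ * ∑ i, ‖Finsupp.linearCombination ℝ x (c i)‖ ≤ ‖∑ i, Finsupp.linearCombination ℝ x (c i)‖}

/-- The supremum defining `δ_α` is finite as soon as some `x_k` is non-zero. -/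
theorem delta_bddAbove (α : ℕ) (x : ℕ+ → V) (k : ℕ+) (hk : x k ≠ 0) :
    BddAbove {δ : ℝ | 0 ≤ δ ∧ ∀ (n : ℕ) (c : Fin n → (ℕ+ →₀ ℝ)),
      Admissible α (fun i => ran (c i)) →
      δ * ∑ i, ‖Finsupp.linearCombination ℝ x (c i)‖
        ≤ ‖∑ i, Finsupp.linearCombination ℝ x (c i)‖} := by
  have hS : ∀ α, ({k} : Finset ℕ+) ∈ Schreier α := by
    intro α
    induction α with
    | zero => simp [Schreier]
    | succ α ih =>
      refine ⟨1, fun _ => {k}, fun _ => ih, fun _ l _ => one_le, fun i j hij => ?_, ?_⟩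
      · have hi := i.isLt
        have hj := j.isLt
        have h1 : ((1 : ℕ+) : ℕ) = 1 := rfl
        have := Fin.lt_def.1 hij
        omega
      · ext l
        simp only [Finset.mem_singleton, Finset.mem_biUnion, Finset.mem_univ, true_and]
        exact ⟨fun hl => ⟨⟨0, Nat.one_pos⟩, hl⟩, fun ⟨_, hl⟩ => hl⟩
  refine ⟨1, fun δ hδ => ?_⟩
  have hadm : Admissible α (fun _ : Fin 1 => ran (Finsupp.single k (1 : ℝ))) := by
    refine ⟨fun i j hij => ?_, fun _ => k, fun _ => ?_, ?_⟩
    · exact absurd hij (by simp [Subsingleton.elim i j])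
    · refine ⟨⟨k, by simp, k, by simp, le_rfl, le_rfl⟩, ?_⟩
      rintro l ⟨a, ha, b, -, hal, -⟩
      have : a = k := by simpa using ha
      exact this ▸ hal
    · convert hS α
      ext l
      simp [eq_comm]
  have h1 := hδ.2 1 (fun _ => Finsupp.single k (1 : ℝ)) hadm
  simp only [Finsupp.linearCombination_single, one_smul, Fin.sum_univ_one] at h1
  have h2 : 0 < ‖x k‖ := norm_pos_iff.2 hk
  exact le_of_mul_le_mul_right (by rwa [one_mul]) h2

end Block

/-! ### The limit defining `θ` exists -/

theorem tendsto_rootLim {θ : ℕ+ → ℝ} (h : IsRegular θ) :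
    Tendsto (fun n : ℕ+ => θ n ^ (1 / (n : ℝ))) atTop (𝓝 (rootLim θ)) ∧
      ∀ n : ℕ+, θ n ≤ rootLim θ ^ (n : ℕ) := by
  let u : ℕ → ℝ := fun n => if hn : 0 < n then -Real.log (θ ⟨n, hn⟩) else 0
  have hu : ∀ n : ℕ+, u n = -Real.log (θ n) := fun n => dif_pos n.pos
  have hsub : Subadditive u := by
    intro m n
    rcases Nat.eq_zero_or_pos m with rfl | hm
    · simp [u]
    rcases Nat.eq_zero_or_pos n with rfl | hn
    · simp [u]
    have h1 := h.mul_le ⟨m, hm⟩ ⟨n, hn⟩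
    have p1 := h.pos ⟨m, hm⟩
    have p2 := h.pos ⟨n, hn⟩
    have h2 := Real.log_le_log (mul_pos p1 p2) h1
    rw [Real.log_mul p1.ne' p2.ne'] at h2
    have e1 := hu (⟨m, hm⟩ + ⟨n, hn⟩)
    have e2 := hu ⟨m, hm⟩
    have e3 := hu ⟨n, hn⟩
    simp only [PNat.mk_coe] at e2 e3
    change u (m + n) = _ at e1
    rw [e1, e2, e3]
    linarith
  have hnn : ∀ n, 0 ≤ u n := by
    intro n
    rcases Nat.eq_zero_or_pos n with rfl | hn
    · simp [u]
    · have := hu ⟨n, hn⟩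
      simp only [PNat.mk_coe] at this
      rw [this]
      have := Real.log_nonpos (h.pos ⟨n, hn⟩).le (h.lt_one ⟨n, hn⟩).le
      linarith
  have hbdd : BddBelow (Set.range fun n => u n / n) :=
    ⟨0, by rintro _ ⟨n, rfl⟩; exact div_nonneg (hnn n) (Nat.cast_nonneg n)⟩
  have hpt : ∀ n : ℕ+, θ n ^ (1 / (n : ℝ)) = Real.exp (-(u n / n)) := by
    intro n
    rw [Real.rpow_def_of_pos (h.pos n), hu]
    congr 1
    ring
  have hcoe : Tendsto (fun n : ℕ+ => (n : ℕ)) atTop atTop :=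
    tendsto_atTop_atTop.2 fun b => ⟨b.succPNat, fun a ha =>
      (Nat.le_succ b).trans (by exact_mod_cast ha)⟩
  have hlim : Tendsto (fun n : ℕ+ => θ n ^ (1 / (n : ℝ))) atTop (𝓝 (Real.exp (-hsub.lim))) := by
    simp only [hpt]
    exact (Real.continuous_exp.tendsto _).comp ((hsub.tendsto_lim hbdd).comp hcoe).neg
  have heq : rootLim θ = Real.exp (-hsub.lim) := hlim.limUnder_eq
  refine ⟨heq ▸ hlim, fun n => ?_⟩
  have h1 := hsub.lim_le_div hbdd n.pos.ne'
  rw [heq, ← Real.exp_nat_mul, ← Real.log_le_iff_le_exp (h.pos n)]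
  have hn : (0 : ℝ) < n := by exact_mod_cast n.pos
  rw [le_div_iff₀ hn, hu] at h1
  linarith

theorem rootLim_pos {θ : ℕ+ → ℝ} (h : IsRegular θ) : 0 < rootLim θ := by
  have := (tendsto_rootLim h).2 1
  simp only [PNat.one_coe, pow_one] at this
  exact (h.pos 1).trans_le this

/-- `φ_n ≤ 1`; in particular the suprema of the `φ_n` are finite. -/
theorem phi_le_one {θ : ℕ+ → ℝ} (h : IsRegular θ) (n : ℕ+) : phi θ n ≤ 1 :=
  div_le_one_of_le₀ ((tendsto_rootLim h).2 n) (pow_pos (rootLim_pos h) _).le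

end MixedTsirelson

namespace MixedTsirelson

/-! Put `C = θ^j sup_{p ≥ j} φ_p`. Unwinding `φ_p`, this says `θ_{j+m} ≤ C θ^m` for all `m ≥ 0`. The
bound `δ_j(Y) ≤ C` already holds by itself (`delta_le`), so the second term of the maximum is not
needed. It is enough to find, for every `η > 0`, normalized blocks `x_i` of `Y` and a convex
combination `∑ a_i x_i` over a `j`-admissible set whose norm is at most `C + O(η)`.

The coefficients are repeated averages (`exists_average`): they give weight at most `η` to every
Schreier set of order below `j`. To estimate the norm, unfold the implicit equation repeatedly
(`mul_nrm_comb_le`). While the total order of the splittings is below `j`, the blocks that are cut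
have small total weight. When the order reaches `j + m`, the accumulated coefficient is at most
`θ_{j+m} ≤ C θ^m`. Uncut blocks then contribute at most `C` times their weight. Apart from a set of
small weight, a cut block sees only the surplus order `m`. Its contribution is about `C` provided
that `θ^m ∑ ‖E x_i‖ ≤ 1 + η` over partitions of order `m`, for all `m` up to a large bound.

Such blocks exist in every block subspace (`exists_small_cellSum`). Otherwise every combination
could be split with a gain `ρ > 1`. After `T` rounds, `ρ^T ‖x‖` would be at most `∑_{b ≤ TM} θ^b ∑
‖E x‖`, over partitions of order `b`, plus an error that averaging makes negligible. For `x`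
supported far out these partitions are `(b+1)`-admissible, so the sum is at most `‖x‖ ∑_b
θ^b/θ_{b+1}`. Since `θ_n^{1/n} → θ`, the last sum grows subexponentially in `T`, a contradiction.

Throughout, a partition is encoded by the finite set `G` of starting points of its intervals `cell G
g`. Extending the sets of an admissible family to these intervals only increases the norms, so the
implicit equation can be read in terms of `cellSum`. -/

/-! ### Schreier families -/

/-- Unions of `n` successive members of the Schreier family `S_a`. -/
def Fam (a : ℕ) : ℕ → Set (Finset ℕ+)
  | 0 => {∅}
  | n + 1 => {F | ∃ G H, G ∈ Schreier a ∧ H ∈ Fam a n ∧ (∀ x ∈ G, ∀ y ∈ H, x < y) ∧ F = G ∪ H}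

/-- Heredity and spreading in one statement: a decomposition of `F` pulls back along `φ`, and `φ x ≤
x` preserves the lower bounds on the elements of the pieces. -/
theorem mem_schreier_of_map {a : ℕ} {F F' : Finset ℕ+} (φ : ℕ+ → ℕ+)
    (hF : F ∈ Schreier a) (hφ : StrictMonoOn φ F') (hm : ∀ x ∈ F', φ x ∈ F)
    (hle : ∀ x ∈ F', φ x ≤ x) : F' ∈ Schreier a := by
  induction a generalizing F F' with
  | zero =>
    exact (Finset.card_le_card_of_injOn φ hm hφ.injOn).trans hF
  | succ a ih =>
    obtain ⟨n, G, h1, h2, h3, rfl⟩ := hF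
    refine ⟨n, fun i => F'.filter (fun x => φ x ∈ G i), fun i => ?_, ?_, ?_, ?_⟩
    · refine ih (h1 i) (hφ.mono fun x hx => (Finset.mem_filter.1 hx).1) ?_ ?_
      · intro x hx; exact (Finset.mem_filter.1 hx).2
      · intro x hx; exact hle x (Finset.mem_filter.1 hx).1
    · intro i k hk
      have := Finset.mem_filter.1 hk
      exact (h2 i _ this.2).trans (hle k this.1)
    · intro i j hij x hx y hy
      have hx := Finset.mem_filter.1 hx
      have hy := Finset.mem_filter.1 hy
      exact (hφ.lt_iff_lt hx.1 hy.1).1 (h3 i j hij _ hx.2 _ hy.2)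
    · ext x
      simp only [Finset.mem_biUnion, Finset.mem_univ, true_and, Finset.mem_filter]
      constructor
      · intro hx
        have := hm x hx
        simp only [Finset.mem_biUnion, Finset.mem_univ, true_and] at this
        obtain ⟨i, hi⟩ := this
        exact ⟨i, hx, hi⟩
      · rintro ⟨i, hx, -⟩; exact hx

theorem mem_fam_of_map {a n : ℕ} {F F' : Finset ℕ+} (φ : ℕ+ → ℕ+)
    (hF : F ∈ Fam a n) (hφ : StrictMonoOn φ F') (hm : ∀ x ∈ F', φ x ∈ F)
    (hle : ∀ x ∈ F', φ x ≤ x) : F' ∈ Fam a n := by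
  induction n generalizing F F' with
  | zero =>
    have hF : F = ∅ := hF
    subst hF
    exact Finset.eq_empty_of_forall_notMem fun x hx => by simpa using hm x hx
  | succ n ih =>
    obtain ⟨G, H, hG, hH, hGH, rfl⟩ := hF
    refine ⟨F'.filter (fun x => φ x ∈ G), F'.filter (fun x => φ x ∈ H), ?_, ?_, ?_, ?_⟩
    · refine mem_schreier_of_map φ hG (hφ.mono fun x hx => (Finset.mem_filter.1 hx).1) ?_ ?_
      · intro x hx; exact (Finset.mem_filter.1 hx).2
      · intro x hx; exact hle x (Finset.mem_filter.1 hx).1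
    · refine ih hH (hφ.mono fun x hx => (Finset.mem_filter.1 hx).1) ?_ ?_
      · intro x hx; exact (Finset.mem_filter.1 hx).2
      · intro x hx; exact hle x (Finset.mem_filter.1 hx).1
    · intro x hx y hy
      have hx := Finset.mem_filter.1 hx
      have hy := Finset.mem_filter.1 hy
      exact (hφ.lt_iff_lt hx.1 hy.1).1 (hGH _ hx.2 _ hy.2)
    · ext x
      simp only [Finset.mem_union, Finset.mem_filter]
      constructor
      · intro hx
        have := Finset.mem_union.1 (hm x hx)
        tauto
      · tauto

theorem schreier_subset {a : ℕ} {F F' : Finset ℕ+} (hF : F ∈ Schreier a) (h : F' ⊆ F) :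
    F' ∈ Schreier a :=
  mem_schreier_of_map id hF (strictMono_id.strictMonoOn _) (fun _ hx => h hx) fun _ _ => le_rfl

theorem fam_subset {a n : ℕ} {F F' : Finset ℕ+} (hF : F ∈ Fam a n) (h : F' ⊆ F) :
    F' ∈ Fam a n :=
  mem_fam_of_map id hF (strictMono_id.strictMonoOn _) (fun _ hx => h hx) fun _ _ => le_rfl

theorem empty_mem_schreier (a : ℕ) : ∅ ∈ Schreier a := by
  induction a with
  | zero => simp [Schreier]
  | succ a ih => exact ⟨1, fun _ => ∅, fun _ => ih, by simp, by simp, by ext; simp⟩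

theorem empty_mem_fam (a n : ℕ) : ∅ ∈ Fam a n := by
  induction n with
  | zero => rfl
  | succ n ih => exact ⟨∅, ∅, empty_mem_schreier a, ih, by simp, by simp⟩

theorem mem_fam_one {a : ℕ} {F : Finset ℕ+} : F ∈ Fam a 1 ↔ F ∈ Schreier a := by
  constructor
  · rintro ⟨G, H, hG, hH, -, rfl⟩
    have hH : H = ∅ := hH
    subst hH
    simpa using hG
  · intro hF
    exact ⟨F, ∅, hF, rfl, by simp, by simp⟩

theorem fam_union {a n n' : ℕ} {G H : Finset ℕ+} (hG : G ∈ Fam a n) (hH : H ∈ Fam a n')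
    (hGH : ∀ x ∈ G, ∀ y ∈ H, x < y) : G ∪ H ∈ Fam a (n + n') := by
  induction n generalizing G with
  | zero =>
    have hG : G = ∅ := hG
    subst hG
    simpa using hH
  | succ n ih =>
    obtain ⟨G₁, G₂, h1, h2, h3, rfl⟩ := hG
    have h4 := ih h2 fun x hx y hy => hGH x (Finset.mem_union_right _ hx) y hy
    rw [Nat.succ_add]
    refine ⟨G₁, G₂ ∪ H, h1, h4, ?_, Finset.union_assoc _ _ _⟩
    intro x hx y hy
    rcases Finset.mem_union.1 hy with hy | hy
    · exact h3 x hx y hy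
    · exact hGH x (Finset.mem_union_left _ hx) y hy

theorem fam_split {a n n' : ℕ} {F : Finset ℕ+} (hF : F ∈ Fam a (n + n')) :
    ∃ G H, G ∈ Fam a n ∧ H ∈ Fam a n' ∧ (∀ x ∈ G, ∀ y ∈ H, x < y) ∧ F = G ∪ H := by
  induction n generalizing F with
  | zero => exact ⟨∅, F, rfl, by simpa using hF, by simp, by simp⟩
  | succ n ih =>
    rw [Nat.succ_add] at hF
    obtain ⟨G₁, F₂, h1, h2, h3, rfl⟩ := hF
    obtain ⟨G₂, H, h4, h5, h6, rfl⟩ := ih h2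
    refine ⟨G₁ ∪ G₂, H, ⟨G₁, G₂, h1, h4, ?_, rfl⟩, h5, ?_, (Finset.union_assoc _ _ _).symm⟩
    · exact fun x hx y hy => h3 x hx y (Finset.mem_union_left _ hy)
    · intro x hx y hy
      rcases Finset.mem_union.1 hx with hx | hx
      · exact h3 x hx y (Finset.mem_union_right _ hy)
      · exact h6 x hx y hy

theorem fam_mono_right {a n n' : ℕ} (h : n ≤ n') {F : Finset ℕ+} (hF : F ∈ Fam a n) :
    F ∈ Fam a n' := by
  obtain ⟨k, rfl⟩ := Nat.exists_eq_add_of_le h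
  simpa using fam_union hF (empty_mem_fam a k) (by simp)

theorem biUnion_mem_fam {a n : ℕ} (G : Fin n → Finset ℕ+) (hG : ∀ i, G i ∈ Schreier a)
    (hlt : ∀ i j, i < j → ∀ x ∈ G i, ∀ y ∈ G j, x < y) : Finset.univ.biUnion G ∈ Fam a n := by
  induction n with
  | zero => simp [Fam]
  | succ n ih =>
    refine ⟨G 0, Finset.univ.biUnion (fun i : Fin n => G i.succ), hG 0,
      ih _ (fun i => hG _) (fun i j hij => hlt _ _ (Fin.succ_lt_succ_iff.2 hij)), ?_, ?_⟩
    · intro x hx y hy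
      simp only [Finset.mem_biUnion, Finset.mem_univ, true_and] at hy
      obtain ⟨i, hi⟩ := hy
      exact hlt _ _ (Fin.succ_pos i) x hx y hi
    · ext x
      simp [Fin.exists_fin_succ]

theorem exists_of_mem_fam {a n : ℕ} {F : Finset ℕ+} (hF : F ∈ Fam a n) :
    ∃ G : Fin n → Finset ℕ+, (∀ i, G i ∈ Schreier a) ∧
      (∀ i j, i < j → ∀ x ∈ G i, ∀ y ∈ G j, x < y) ∧ F = Finset.univ.biUnion G := by
  induction n generalizing F with
  | zero => exact ⟨fun _ => ∅, fun i => i.elim0, fun i => i.elim0, by simpa [Fam] using hF⟩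
  | succ n ih =>
    obtain ⟨G₁, F₂, h1, h2, h3, rfl⟩ := hF
    obtain ⟨G, h4, h5, rfl⟩ := ih h2
    refine ⟨Fin.cons G₁ G, ?_, ?_, ?_⟩
    · intro i
      refine Fin.cases ?_ (fun i => ?_) i
      · simpa using h1
      · simpa using h4 i
    · intro i j
      refine Fin.cases ?_ (fun i => ?_) i <;> refine Fin.cases ?_ (fun j => ?_) j
      · simp
      · intro _ x hx y hy
        exact h3 x (by simpa using hx) y
          (Finset.mem_biUnion.2 ⟨j, Finset.mem_univ _, by simpa using hy⟩)
      · simp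
      · intro hij
        simpa using h5 i j (Fin.succ_lt_succ_iff.1 hij)
    · ext x
      simp [Fin.exists_fin_succ]

/-- Trades the indexed unions of the definition for the recursive `Fam`, on which inductions over
the number of pieces are run. -/
theorem mem_schreier_succ {a : ℕ} {F : Finset ℕ+} :
    F ∈ Schreier (a + 1) ↔ ∃ n : ℕ, F ∈ Fam a n ∧ ∀ k ∈ F, n ≤ (k : ℕ) := by
  constructor
  · rintro ⟨n, G, h1, h2, h3, rfl⟩
    refine ⟨n, biUnion_mem_fam G h1 h3, fun k hk => ?_⟩
    simp only [Finset.mem_biUnion, Finset.mem_univ, true_and] at hk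
    obtain ⟨i, hi⟩ := hk
    exact_mod_cast h2 i k hi
  · rintro ⟨n, hF, hn⟩
    -- The definition asks for a positive number of pieces, and `n = 0` is allowed here; one empty
    -- piece repairs this.
    have hF' : F ∈ Fam a (max n 1) := fam_mono_right (le_max_left _ _) hF
    have hn' : ∀ k ∈ F, max n 1 ≤ (k : ℕ) := fun k hk => max_le (hn k hk) k.pos
    obtain ⟨G, h1, h2, rfl⟩ := exists_of_mem_fam hF'
    refine ⟨⟨max n 1, by positivity⟩, G, h1, ?_, h2, rfl⟩
    intro i k hk
    exact hn' k (Finset.mem_biUnion.2 ⟨i, Finset.mem_univ _, hk⟩)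

theorem schreier_mono {a b : ℕ} (h : a ≤ b) {F : Finset ℕ+} (hF : F ∈ Schreier a) :
    F ∈ Schreier b := by
  induction b, h using Nat.le_induction with
  | base => exact hF
  | succ b _ ih => exact mem_schreier_succ.2 ⟨1, mem_fam_one.2 ih, fun k _ => k.pos⟩

theorem fam_mono_left {a b n : ℕ} (h : a ≤ b) {F : Finset ℕ+} (hF : F ∈ Fam a n) :
    F ∈ Fam b n := by
  induction n generalizing F with
  | zero => exact hF
  | succ n ih =>
    obtain ⟨G, H, h1, h2, h3, rfl⟩ := hF
    exact ⟨G, H, schreier_mono h h1, ih h2, h3, rfl⟩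

/-- Grouping `n * g` successive sets into `n` groups of `g` sets. -/
theorem fam_group {a n g : ℕ} {F : Finset ℕ+} (hF : F ∈ Fam a (n * g))
    (hg : ∀ k ∈ F, g ≤ (k : ℕ)) : F ∈ Fam (a + 1) n := by
  induction n generalizing F with
  | zero => simpa [Fam] using hF
  | succ n ih =>
    rw [Nat.succ_mul, Nat.add_comm] at hF
    obtain ⟨G, H, h1, h2, h3, rfl⟩ := fam_split hF
    exact ⟨G, H, mem_schreier_succ.2 ⟨g, h1, fun k hk => hg k (Finset.mem_union_left _ hk)⟩,
      ih h2 fun k hk => hg k (Finset.mem_union_right _ hk), h3, rfl⟩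

/-- Composition of Schreier families. -/
theorem biUnion_mem_fam_mul {m a n n' : ℕ} {H : Finset ℕ+} (hH : H ∈ Fam m n)
    (G : ℕ+ → Finset ℕ+) (hG : ∀ h ∈ H, G h ∈ Fam a n') (hle : ∀ h ∈ H, ∀ x ∈ G h, h ≤ x)
    (hlt : ∀ h ∈ H, ∀ h' ∈ H, h < h' → ∀ x ∈ G h, ∀ y ∈ G h', x < y) :
    H.biUnion G ∈ Fam (m + a) (n * n') := by
  -- The passage from one member of `S_m` to `n` successive ones is isolated because it is needed
  -- both for the statement itself and, with `n = g`, inside the induction on `m`.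
  have key : ∀ m, (∀ H : Finset ℕ+, H ∈ Schreier m → (∀ h ∈ H, G h ∈ Fam a n') →
      (∀ h ∈ H, ∀ x ∈ G h, h ≤ x) →
      (∀ h ∈ H, ∀ h' ∈ H, h < h' → ∀ x ∈ G h, ∀ y ∈ G h', x < y) →
      H.biUnion G ∈ Fam (m + a) n') →
      ∀ n, ∀ H : Finset ℕ+, H ∈ Fam m n → (∀ h ∈ H, G h ∈ Fam a n') →
      (∀ h ∈ H, ∀ x ∈ G h, h ≤ x) →
      (∀ h ∈ H, ∀ h' ∈ H, h < h' → ∀ x ∈ G h, ∀ y ∈ G h', x < y) →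
      H.biUnion G ∈ Fam (m + a) (n * n') := by
    intro m hm n
    induction n with
    | zero =>
      intro H hH _ _ _
      have hH : H = ∅ := hH
      subst hH
      simpa using empty_mem_fam _ _
    | succ n ih =>
      rintro H ⟨H₁, H₂, h1, h2, h3, rfl⟩ hG hle hlt
      rw [Finset.union_biUnion, Nat.succ_mul, Nat.add_comm (n * n')]
      refine fam_union (hm H₁ h1 ?_ ?_ ?_) (ih H₂ h2 ?_ ?_ ?_) ?_
      · exact fun h hh => hG h (Finset.mem_union_left _ hh)
      · exact fun h hh => hle h (Finset.mem_union_left _ hh)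
      · exact fun h hh h' hh' =>
          hlt h (Finset.mem_union_left _ hh) h' (Finset.mem_union_left _ hh')
      · exact fun h hh => hG h (Finset.mem_union_right _ hh)
      · exact fun h hh => hle h (Finset.mem_union_right _ hh)
      · exact fun h hh h' hh' =>
          hlt h (Finset.mem_union_right _ hh) h' (Finset.mem_union_right _ hh')
      · intro x hx y hy
        obtain ⟨h, hh, hx⟩ := Finset.mem_biUnion.1 hx
        obtain ⟨h', hh', hy⟩ := Finset.mem_biUnion.1 hy
        exact hlt h (Finset.mem_union_left _ hh) h' (Finset.mem_union_right _ hh')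
          (h3 h hh h' hh') x hx y hy
  refine key m ?_ n H hH hG hle hlt
  clear hH hG hle hlt H
  induction m with
  | zero =>
    intro H hH hG _ _
    rw [Nat.zero_add]
    rcases Finset.card_le_one_iff_subset_singleton.1 hH with ⟨h, hh⟩
    rcases Finset.subset_singleton_iff.1 hh with rfl | rfl
    · simpa using empty_mem_fam _ _
    · simpa using hG h (by simp)
  | succ m ih =>
    intro H hH hG hle hlt
    obtain ⟨g, h1, h2⟩ := mem_schreier_succ.1 hH
    have h3 := key m ih g H h1 hG hle hlt
    -- The union consists of `g * n'` sets; read as `n'` groups of `g`, each group lies beyond `g`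
    -- and so merges into one set of the next order.
    rw [Nat.mul_comm] at h3
    rw [Nat.succ_add]
    refine fam_group h3 fun k hk => ?_
    obtain ⟨h, hh, hk⟩ := Finset.mem_biUnion.1 hk
    exact (h2 h hh).trans (by exact_mod_cast hle h hh k hk)

/-! ### The partition of a half line into intervals starting at the points of a finite set -/

/-- The interval from `g` up to the next element of `G`. -/
def cell (G : Finset ℕ+) (g : ℕ+) : Set ℕ+ := {z | g ≤ z ∧ ∀ g' ∈ G, g' ≤ z → g' ≤ g}

theorem mem_cell_unique {G : Finset ℕ+} {g g' z : ℕ+} (hg : g ∈ G) (hg' : g' ∈ G)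
    (h : z ∈ cell G g) (h' : z ∈ cell G g') : g = g' :=
  le_antisymm (h'.2 g hg h.1) (h.2 g' hg' h'.1)

theorem lt_of_mem_cell {G : Finset ℕ+} {g g' x y : ℕ+} (hg' : g' ∈ G) (hlt : g < g')
    (hx : x ∈ cell G g) (hy : y ∈ cell G g') : x < y := by
  by_contra hxy
  exact absurd (hx.2 g' hg' (hy.1.trans (not_lt.1 hxy))) (not_le.2 hlt)

theorem exists_mem_cell {G : Finset ℕ+} {g z : ℕ+} (hg : g ∈ G) (hgz : g ≤ z) :
    ∃ g' ∈ G, g ≤ g' ∧ z ∈ cell G g' := by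
  have hne : (G.filter (· ≤ z)).Nonempty := ⟨g, Finset.mem_filter.2 ⟨hg, hgz⟩⟩
  have hmem := Finset.mem_filter.1 (Finset.max'_mem _ hne)
  refine ⟨_, hmem.1, Finset.le_max' _ _ (Finset.mem_filter.2 ⟨hg, hgz⟩), hmem.2, ?_⟩
  exact fun g' hg' hle => Finset.le_max' _ _ (Finset.mem_filter.2 ⟨hg', hle⟩)

/-- Every member of `S_{r+m}` is a union of successive members of `S_m`, the set of whose minima
belongs to `S_r`. -/
theorem exists_schreier_decomposition {m r : ℕ} {G : Finset ℕ+} (hG : G ∈ Schreier (r + m)) :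
    ∃ U ⊆ G, U ∈ Schreier r ∧ (∀ g ∈ G, ∃ u ∈ U, u ≤ g) ∧
      ∀ u ∈ U, (∃ K ∈ Schreier m, ∀ g ∈ G, g ∈ cell U u → g ∈ K) := by
  induction r generalizing G with
  | zero =>
    rw [Nat.zero_add] at hG
    rcases G.eq_empty_or_nonempty with rfl | hne
    · exact ⟨∅, by simp, empty_mem_schreier 0, by simp, by simp⟩
    · refine ⟨{G.min' hne}, by simpa using G.min'_mem hne, by simp [Schreier], ?_, ?_⟩
      · exact fun g hg => ⟨_, by simp, G.min'_le g hg⟩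
      · exact fun u _ => ⟨G, hG, fun g hg _ => hg⟩
  | succ r ih =>
    rw [Nat.succ_add] at hG
    obtain ⟨n, hF, hn⟩ := mem_schreier_succ.1 hG
    suffices h : ∃ U ⊆ G, U ∈ Fam r n ∧ (∀ g ∈ G, ∃ u ∈ U, u ≤ g) ∧
        ∀ u ∈ U, (∃ K ∈ Schreier m, ∀ g ∈ G, g ∈ cell U u → g ∈ K) by
      obtain ⟨U, h1, h2, h3⟩ := h
      exact ⟨U, h1, mem_schreier_succ.2 ⟨n, h2, fun k hk => hn k (h1 hk)⟩, h3⟩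
    clear hG hn
    induction n generalizing G with
    | zero =>
      have hF : G = ∅ := hF
      subst hF
      exact ⟨∅, by simp, rfl, by simp, by simp⟩
    | succ n ihn =>
      obtain ⟨G₁, G₂, h1, h2, h3, rfl⟩ := hF
      obtain ⟨U₁, a1, a2, a3, a4⟩ := ih h1
      obtain ⟨U₂, b1, b2, b3, b4⟩ := ihn h2
      refine ⟨U₁ ∪ U₂, Finset.union_subset_union a1 b1,
        ⟨U₁, U₂, a2, b2, fun x hx y hy => h3 x (a1 hx) y (b1 hy), rfl⟩, ?_, ?_⟩
      · intro g hg
        rcases Finset.mem_union.1 hg with hg | hg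
        · obtain ⟨u, hu, hle⟩ := a3 g hg
          exact ⟨u, Finset.mem_union_left _ hu, hle⟩
        · obtain ⟨u, hu, hle⟩ := b3 g hg
          exact ⟨u, Finset.mem_union_right _ hu, hle⟩
      · intro u hu
        rcases Finset.mem_union.1 hu with hu | hu
        · obtain ⟨K, hK, hK'⟩ := a4 u hu
          refine ⟨K, hK, fun g hg hc => ?_⟩
          rcases Finset.mem_union.1 hg with hg | hg
          · exact hK' g hg ⟨hc.1, fun g' hg' => hc.2 g' (Finset.mem_union_left _ hg')⟩
          · obtain ⟨u', hu', hle⟩ := b3 g hg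
            have := hc.2 u' (Finset.mem_union_right _ hu') hle
            exact absurd (h3 u (a1 hu) u' (b1 hu')) (not_lt.2 this)
        · obtain ⟨K, hK, hK'⟩ := b4 u hu
          refine ⟨K, hK, fun g hg hc => ?_⟩
          rcases Finset.mem_union.1 hg with hg | hg
          · exact absurd (h3 g hg u (b1 hu)) (not_lt.2 hc.1)
          · exact hK' g hg ⟨hc.1, fun g' hg' => hc.2 g' (Finset.mem_union_right _ hg')⟩

/-! ### Convex combinations that are small on Schreier sets of lower order -/

theorem sum_le_of_mem_fam {ι : Type*} {t : ι → ℕ+} {a : ι → ℝ} (ha : ∀ i, 0 ≤ a i) {r : ℕ}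
    {ε : ℝ} (h : ∀ B : Finset ι, B.image t ∈ Schreier r → ∑ i ∈ B, a i ≤ ε) (g : ℕ)
    (B : Finset ι) (hB : B.image t ∈ Fam r g) : ∑ i ∈ B, a i ≤ g * ε := by
  classical
  induction g generalizing B with
  | zero =>
    have : B.image t = ∅ := hB
    rw [Finset.image_eq_empty] at this
    simp [this]
  | succ g ih =>
    obtain ⟨G, H, h1, h2, -, h4⟩ := hB
    have e1 := h (B.filter (fun i => t i ∈ G)) (schreier_subset h1 (by
      intro x hx
      obtain ⟨i, hi, rfl⟩ := Finset.mem_image.1 hx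
      exact (Finset.mem_filter.1 hi).2))
    have e2 := ih (B.filter (fun i => t i ∈ H)) (fam_subset h2 (by
      intro x hx
      obtain ⟨i, hi, rfl⟩ := Finset.mem_image.1 hx
      exact (Finset.mem_filter.1 hi).2))
    have e3 : ∑ i ∈ B, a i ≤ ∑ i ∈ B.filter (fun i => t i ∈ G), a i +
        ∑ i ∈ B.filter (fun i => t i ∈ H), a i := by
      rw [← Finset.sum_union_inter]
      refine le_add_of_le_of_nonneg ?_ (Finset.sum_nonneg fun i _ => ha i)
      refine Finset.sum_le_sum_of_subset_of_nonneg ?_ fun i _ _ => ha i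
      intro i hi
      have : t i ∈ G ∪ H := h4 ▸ Finset.mem_image_of_mem t hi
      simp only [Finset.mem_union, Finset.mem_filter] at this ⊢
      tauto
    push_cast
    linarith

theorem strictMono_of_interlaced {s t : ℕ → ℕ+} (hst : ∀ i, s i ≤ t i)
    (hts : ∀ i, t i < s (i + 1)) : StrictMono s ∧ StrictMono t :=
  ⟨strictMono_nat_of_lt_succ fun i => (hst i).trans_lt (hts i),
    strictMono_nat_of_lt_succ fun i => (hts i).trans_le (hst (i + 1))⟩

theorem lt_of_interlaced {s t : ℕ → ℕ+} (hst : ∀ i, s i ≤ t i)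
    (hts : ∀ i, t i < s (i + 1)) {i j : ℕ} (h : i < j) : t i < s j :=
  (hts i).trans_le ((strictMono_of_interlaced hst hts).1.monotone h)

theorem le_coe_of_strictMono {s : ℕ → ℕ+} (hs : StrictMono s) (i : ℕ) : i ≤ (s i : ℕ) := by
  have : StrictMono (fun i => (s i : ℕ)) := fun i j h => hs h
  exact this.id_le i

/-- Repeated averages: level `j + 1` is the mean of `n` successive level-`j` averages, each far more
spread out than its predecessors. The support is measured by the left endpoints `s`, which yields
admissibility, while smallness is measured by the right endpoints `t`, the form in which cut blocks
are counted later. -/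
theorem exists_average {s t : ℕ → ℕ+} (hst : ∀ i, s i ≤ t i) (hts : ∀ i, t i < s (i + 1))
    (j : ℕ) {ε : ℝ} (hε : 0 < ε) (i₀ : ℕ) :
    ∃ (F : Finset ℕ) (a : ℕ → ℝ), (∀ i ∈ F, i₀ ≤ i) ∧ (∀ i, 0 ≤ a i) ∧ (∀ i ∈ F, 0 < a i) ∧
      (∀ i, i ∉ F → a i = 0) ∧ ∑ i ∈ F, a i = 1 ∧ F.image s ∈ Schreier j ∧
      ∀ r < j, ∀ B : Finset ℕ, B.image t ∈ Schreier r → ∑ i ∈ B, a i ≤ ε := by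
  obtain ⟨hs, ht⟩ := strictMono_of_interlaced hst hts
  induction j generalizing ε i₀ with
  | zero =>
    refine ⟨{i₀}, fun i => if i = i₀ then 1 else 0, by simp, ?_, by simp, ?_, by simp, ?_, ?_⟩
    · intro i; dsimp only; split_ifs <;> norm_num
    · intro i hi; simpa using hi
    · simp [Schreier]
    · intro r hr; omega
  | succ j ih =>
    -- The sum of `n` averages, before division by `n`. A set of order `j` gets weight at most `1`
    -- from the first average that it meets and at most `δ` from each later one.
    have blocks : ∀ (δ : ℝ), 0 < δ → ∀ (i₀ n : ℕ), ∃ (F : Finset ℕ) (a : ℕ → ℝ),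
        (∀ i ∈ F, i₀ ≤ i) ∧ (∀ i, 0 ≤ a i) ∧ (∀ i ∈ F, 0 < a i) ∧ (∀ i, i ∉ F → a i = 0) ∧
        ∑ i ∈ F, a i = n ∧ F.image s ∈ Fam j n ∧
        ∀ B : Finset ℕ, B.image t ∈ Schreier j → ∑ i ∈ B, a i ≤ 1 + n * δ := by
      intro δ hδ i₀ n
      induction n with
      | zero =>
        exact ⟨∅, fun _ => 0, by simp, by simp, by simp, by simp, by simp, by simp [Fam], by simp⟩
      | succ n ihn =>
        obtain ⟨F, a, h1, h2, h3, h4, h5, h6, h7⟩ := ihn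
        set T := F.sup id with hT
        have hFT : ∀ i ∈ F, i ≤ T := fun i hi => Finset.le_sup (f := id) hi
        have htpos : (0 : ℝ) < (t T : ℕ) := by exact_mod_cast (t T).pos
        -- The tolerance is divided by `t T`, since a set of order `j = r + 1` meeting the earlier
        -- averages has minimum at most `t T` and so splits into at most `t T` sets of order `r`.
        obtain ⟨F', a', k1, k2, k3, k4, k5, k6, k7⟩ :=
          ih (div_pos hδ htpos) (max i₀ (T + 1))
        have hlt : ∀ i ∈ F, ∀ i' ∈ F', i < i' := fun i hi i' hi' =>
          (Nat.lt_succ_of_le (hFT i hi)).trans_le ((le_max_right _ _).trans (k1 i' hi'))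
        have hdisj : Disjoint F F' := Finset.disjoint_left.2 fun i hi hi' =>
          lt_irrefl _ (hlt i hi i hi')
        have hsupp : ∀ (b : ℕ → ℝ) (F B : Finset ℕ), (∀ i, i ∉ F → b i = 0) →
            ∑ i ∈ B, b i = ∑ i ∈ B ∩ F, b i := fun b F B hb =>
          (Finset.sum_subset Finset.inter_subset_left fun i hi hi' =>
            hb i fun h => hi' (Finset.mem_inter.2 ⟨hi, h⟩)).symm
        refine ⟨F ∪ F', fun i => a i + a' i, ?_, fun i => add_nonneg (h2 i) (k2 i), ?_, ?_, ?_,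
          ?_, ?_⟩
        · intro i hi
          rcases Finset.mem_union.1 hi with hi | hi
          · exact h1 i hi
          · exact (le_max_left _ _).trans (k1 i hi)
        · intro i hi
          rcases Finset.mem_union.1 hi with hi | hi
          · exact add_pos_of_pos_of_nonneg (h3 i hi) (k2 i)
          · exact add_pos_of_nonneg_of_pos (h2 i) (k3 i hi)
        · intro i hi
          rw [Finset.mem_union, not_or] at hi
          dsimp only
          rw [h4 i hi.1, k4 i hi.2, add_zero]
        · rw [Finset.sum_add_distrib, hsupp a F _ h4, hsupp a' F' _ k4,
            Finset.inter_eq_right.2 Finset.subset_union_left,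
            Finset.inter_eq_right.2 Finset.subset_union_right, h5, k5]
          push_cast
          ring
        · rw [Finset.image_union]
          refine fam_union h6 (mem_fam_one.2 k6) ?_
          intro x hx y hy
          obtain ⟨i, hi, rfl⟩ := Finset.mem_image.1 hx
          obtain ⟨i', hi', rfl⟩ := Finset.mem_image.1 hy
          exact hs (hlt i hi i' hi')
        · intro B hB
          rw [Finset.sum_add_distrib]
          have hδn : 0 ≤ n * δ := by positivity
          push_cast
          by_cases hBF : ∃ i ∈ B, i ∈ F
          · obtain ⟨i, hiB, hiF⟩ := hBF
            have e1 := h7 B hB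
            suffices e2 : ∑ i ∈ B, a' i ≤ δ by linarith
            cases j with
            | zero =>
              have hB : (B.image t).card ≤ 1 := hB
              rw [Finset.card_image_of_injective _ ht.injective] at hB
              refine le_trans (le_of_eq (Finset.sum_eq_zero fun i' hi' => k4 i' fun h => ?_)) hδ.le
              have := Finset.card_le_one.1 hB i hiB i' hi'
              exact (hlt i hiF i' h).ne this
            | succ r =>
              obtain ⟨g, hg1, hg2⟩ := mem_schreier_succ.1 hB
              have hg : (g : ℝ) ≤ (t T : ℕ) := by
                have := hg2 _ (Finset.mem_image_of_mem t hiB)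
                exact_mod_cast this.trans (ht.monotone (hFT i hiF))
              have e3 := sum_le_of_mem_fam k2 (k7 r (Nat.lt_succ_self r)) g B hg1
              calc _ ≤ g * (δ / (t T : ℕ)) := e3
                _ ≤ (t T : ℕ) * (δ / (t T : ℕ)) := by gcongr
                _ = δ := mul_div_cancel₀ _ htpos.ne'
          · push Not at hBF
            rw [Finset.sum_eq_zero fun i hi => h4 i (hBF i hi), hsupp a' F' B k4]
            have : ∑ i ∈ B ∩ F', a' i ≤ 1 := by
              rw [← k5]
              exact Finset.sum_le_sum_of_subset_of_nonneg Finset.inter_subset_right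
                fun i _ _ => k2 i
            linarith
    -- With `δ = ε / 2` this gives `(1 + n δ) / n ≤ ε`. Starting at index `n` ensures `n ≤ s i`, so
    -- that `n` pieces of order `j` form a set of order `j + 1`.
    obtain ⟨n, hn⟩ := exists_nat_gt (2 / ε)
    have hn0 : (0 : ℝ) < n := (by positivity : (0 : ℝ) < 2 / ε).trans hn
    obtain ⟨F, a, h1, h2, h3, h4, h5, h6, h7⟩ := blocks (ε / 2) (by positivity) (max i₀ n) n
    refine ⟨F, fun i => a i / n, fun i hi => (le_max_left _ _).trans (h1 i hi),
      fun i => div_nonneg (h2 i) hn0.le, fun i hi => div_pos (h3 i hi) hn0,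
      fun i hi => by simp [h4 i hi], ?_, ?_, ?_⟩
    · rw [← Finset.sum_div, h5, div_self hn0.ne']
    · refine mem_schreier_succ.2 ⟨n, h6, fun k hk => ?_⟩
      obtain ⟨i, hi, rfl⟩ := Finset.mem_image.1 hk
      exact ((le_max_right _ _).trans (h1 i hi)).trans (le_coe_of_strictMono hs i)
    · intro r hr B hB
      have e := h7 B (schreier_mono (Nat.le_of_lt_succ hr) hB)
      rw [← Finset.sum_div, div_le_iff₀ hn0]
      rw [div_lt_iff₀ hε] at hn
      linarith

/-! ### Restrictions -/

open Classical in
theorem restrict_apply (E : Set ℕ+) (x : ℕ+ →₀ ℝ) (k : ℕ+) :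
    restrict E x k = if k ∈ E then x k else 0 := by
  unfold restrict
  rw [Finsupp.filter_apply]

theorem restrict_restrict (E E' : Set ℕ+) (x : ℕ+ →₀ ℝ) :
    restrict E (restrict E' x) = restrict (E ∩ E') x := by
  ext k
  simp only [restrict_apply]
  by_cases h1 : k ∈ E <;> by_cases h2 : k ∈ E' <;> simp [h1, h2]

theorem restrict_comm (E E' : Set ℕ+) (x : ℕ+ →₀ ℝ) :
    restrict E (restrict E' x) = restrict E' (restrict E x) := by
  rw [restrict_restrict, restrict_restrict, Set.inter_comm]

theorem restrict_eq_self {E : Set ℕ+} {x : ℕ+ →₀ ℝ} (h : ∀ k ∈ x.support, k ∈ E) :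
    restrict E x = x := by
  ext k
  rw [restrict_apply]
  split_ifs with hk
  · rfl
  · by_contra hne
    exact hk (h k (Finsupp.mem_support_iff.2 (Ne.symm hne)))

theorem restrict_eq_zero {E : Set ℕ+} {x : ℕ+ →₀ ℝ} (h : ∀ k ∈ x.support, k ∉ E) :
    restrict E x = 0 := by
  ext k
  rw [restrict_apply]
  split_ifs with hk
  · by_contra hne
    exact h k (Finsupp.mem_support_iff.2 hne) hk
  · rfl

theorem restrict_zero (E : Set ℕ+) : restrict E (0 : ℕ+ →₀ ℝ) = 0 :=
  restrict_eq_zero (by simp)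

theorem restrict_sum {ι : Type*} (E : Set ℕ+) (A : Finset ι) (x : ι → ℕ+ →₀ ℝ) :
    restrict E (∑ i ∈ A, x i) = ∑ i ∈ A, restrict E (x i) := by
  classical
  induction A using Finset.induction_on with
  | empty => simp [restrict_zero]
  | insert i A hi ih => rw [Finset.sum_insert hi, Finset.sum_insert hi, restrict_add, ih]

/-! ### The norm on finitely supported vectors -/

/-- The mixed Tsirelson norm on `c_00`. -/
noncomputable def nrm (θ : ℕ+ → ℝ) (x : ℕ+ →₀ ℝ) : ℝ := (eNorm θ x).toReal

theorem approx_restrict_le (θ : ℕ+ → ℝ) (m : ℕ) (E : Set ℕ+) (x : ℕ+ →₀ ℝ) :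
    approx θ m (restrict E x) ≤ approx θ m x := by
  induction m generalizing x with
  | zero => exact le_rfl
  | succ m ih =>
    refine sup_le ?_ ?_
    · refine iSup_le fun k => ?_
      refine le_trans ?_ (le_trans (le_iSup (fun k => ‖x k‖ₑ) k) le_sup_left)
      rw [restrict_apply]
      split_ifs <;> simp
    · refine iSup_le fun q => iSup_le fun n => iSup_le fun F => iSup_le fun hF => ?_
      refine le_trans ?_ (le_step θ (approx θ m) x q F hF)
      gcongr with i
      rw [restrict_comm]
      exact ih _

theorem eNorm_restrict_le (θ : ℕ+ → ℝ) (E : Set ℕ+) (x : ℕ+ →₀ ℝ) :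
    eNorm θ (restrict E x) ≤ eNorm θ x :=
  iSup_mono fun m => approx_restrict_le θ m E x

section Norm

variable {θ : ℕ+ → ℝ}

theorem nrm_nonneg (x : ℕ+ →₀ ℝ) : 0 ≤ nrm θ x := ENNReal.toReal_nonneg

theorem nrm_smul (c : ℝ) (x : ℕ+ →₀ ℝ) : nrm θ (c • x) = |c| * nrm θ x := by
  rw [nrm, eNorm_smul, ENNReal.toReal_mul, toReal_enorm, Real.norm_eq_abs, nrm]

theorem nrm_zero : nrm θ 0 = 0 := by
  simpa using nrm_smul (θ := θ) 0 0

theorem nrm_add_le (h : IsRegular θ) (x y : ℕ+ →₀ ℝ) : nrm θ (x + y) ≤ nrm θ x + nrm θ y := by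
  rw [nrm, nrm, nrm, ← ENNReal.toReal_add (eNorm_ne_top h x) (eNorm_ne_top h y)]
  exact ENNReal.toReal_mono (ENNReal.add_ne_top.2 ⟨eNorm_ne_top h x, eNorm_ne_top h y⟩)
    (eNorm_add_le θ _ _)

theorem nrm_sum_le (h : IsRegular θ) {ι : Type*} (A : Finset ι) (x : ι → ℕ+ →₀ ℝ) :
    nrm θ (∑ i ∈ A, x i) ≤ ∑ i ∈ A, nrm θ (x i) :=
  Finset.le_sum_of_subadditive (nrm θ) nrm_zero.le (nrm_add_le h) _ _

theorem abs_le_nrm (h : IsRegular θ) (x : ℕ+ →₀ ℝ) (k : ℕ+) : |x k| ≤ nrm θ x := by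
  have := ENNReal.toReal_mono (eNorm_ne_top h x) (enorm_le_eNorm θ x k)
  rwa [toReal_enorm, Real.norm_eq_abs] at this

theorem nrm_pos (h : IsRegular θ) {x : ℕ+ →₀ ℝ} (hx : x ≠ 0) : 0 < nrm θ x := by
  obtain ⟨k, hk⟩ := Finsupp.ne_iff.1 hx
  exact (abs_pos.2 hk).trans_le (abs_le_nrm h x k)

theorem nrm_restrict_le (h : IsRegular θ) (E : Set ℕ+) (x : ℕ+ →₀ ℝ) :
    nrm θ (restrict E x) ≤ nrm θ x :=
  ENNReal.toReal_mono (eNorm_ne_top h x) (eNorm_restrict_le θ E x)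

theorem nrm_restrict_mono (h : IsRegular θ) {E E' : Set ℕ+} {x : ℕ+ →₀ ℝ}
    (hE : ∀ k ∈ x.support, k ∈ E → k ∈ E') : nrm θ (restrict E x) ≤ nrm θ (restrict E' x) := by
  have : restrict E x = restrict E (restrict E' x) := by
    ext k
    simp only [restrict_apply]
    by_cases hk : k ∈ x.support
    · have := hE k hk
      split_ifs <;> tauto
    · rw [Finsupp.notMem_support_iff.1 hk]
      simp
  rw [this]
  exact nrm_restrict_le h _ _

theorem nrm_le_sum_abs (h : IsRegular θ) (x : ℕ+ →₀ ℝ) : nrm θ x ≤ ∑ k ∈ x.support, |x k| := by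
  conv_lhs => rw [← Finsupp.sum_single x]
  refine (nrm_sum_le h _ _).trans (Finset.sum_le_sum fun k _ => ?_)
  have := ENNReal.toReal_mono enorm_ne_top (eNorm_single_le h k (x k))
  rwa [toReal_enorm, Real.norm_eq_abs] at this

/-- The sum of the norms of the restrictions of `x` to the intervals that start at the points
of `G`. -/
noncomputable def cellSum (θ : ℕ+ → ℝ) (G : Finset ℕ+) (x : ℕ+ →₀ ℝ) : ℝ :=
  ∑ g ∈ G, nrm θ (restrict (cell G g) x)

theorem cellSum_nonneg (G : Finset ℕ+) (x : ℕ+ →₀ ℝ) : 0 ≤ cellSum θ G x :=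
  Finset.sum_nonneg fun _ _ => nrm_nonneg _

theorem cellSum_add_le (h : IsRegular θ) (G : Finset ℕ+) (x y : ℕ+ →₀ ℝ) :
    cellSum θ G (x + y) ≤ cellSum θ G x + cellSum θ G y := by
  rw [cellSum, cellSum, cellSum, ← Finset.sum_add_distrib]
  refine Finset.sum_le_sum fun g _ => ?_
  rw [restrict_add]
  exact nrm_add_le h _ _

theorem cellSum_smul (G : Finset ℕ+) (c : ℝ) (x : ℕ+ →₀ ℝ) :
    cellSum θ G (c • x) = |c| * cellSum θ G x := by
  simp only [cellSum, restrict_smul, nrm_smul, Finset.mul_sum]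

theorem cellSum_sum_le (h : IsRegular θ) (G : Finset ℕ+) {ι : Type*} (A : Finset ι)
    (x : ι → ℕ+ →₀ ℝ) : cellSum θ G (∑ i ∈ A, x i) ≤ ∑ i ∈ A, cellSum θ G (x i) :=
  Finset.le_sum_of_subadditive (cellSum θ G) (by simp [cellSum, restrict_zero, nrm_zero])
    (cellSum_add_le h G) _ _

theorem cellSum_le_sum_abs (h : IsRegular θ) (G : Finset ℕ+) (x : ℕ+ →₀ ℝ) :
    cellSum θ G x ≤ ∑ k ∈ x.support, |x k| := by
  classical
  have h1 : ∀ g ∈ G, nrm θ (restrict (cell G g) x) ≤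
      ∑ k ∈ x.support, if k ∈ cell G g then |x k| else 0 := by
    intro g _
    refine (nrm_le_sum_abs h _).trans ?_
    refine (Finset.sum_le_sum_of_subset_of_nonneg (t := x.support) ?_ fun _ _ _ =>
      abs_nonneg _).trans (le_of_eq (Finset.sum_congr rfl fun k _ => ?_))
    · intro k hk
      rw [Finsupp.mem_support_iff, restrict_apply] at hk
      rw [Finsupp.mem_support_iff]
      intro h0
      simp [h0] at hk
    · rw [restrict_apply]
      split_ifs <;> simp
  refine (Finset.sum_le_sum h1).trans ?_
  rw [Finset.sum_comm]
  refine Finset.sum_le_sum fun k _ => ?_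
  by_cases hk : ∃ g ∈ G, k ∈ cell G g
  · obtain ⟨g, hg, hkg⟩ := hk
    rw [Finset.sum_eq_single_of_mem g hg]
    · simp [hkg]
    · intro g' hg' hne
      rw [if_neg fun hk' => hne (mem_cell_unique hg' hg hk' hkg)]
  · push Not at hk
    rw [Finset.sum_eq_zero fun g hg => if_neg (hk g hg)]
    exact abs_nonneg _

/-- One half of the implicit equation in terms of starting points: the cells of `G` have minima
exactly `G`. -/
theorem mul_cellSum_le (h : IsRegular θ) {q : ℕ+} {G : Finset ℕ+} (hG : G ∈ Schreier q)
    (x : ℕ+ →₀ ℝ) : θ q * cellSum θ G x ≤ nrm θ x := by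
  have hadm : Admissible q (fun i : Fin G.card => cell G (G.orderEmbOfFin rfl i)) := by
    refine ⟨fun i j hij a ha b hb => ?_, fun i => G.orderEmbOfFin rfl i, fun i => ?_, ?_⟩
    · exact lt_of_mem_cell (G.orderEmbOfFin_mem rfl j)
        ((G.orderEmbOfFin rfl).lt_iff_lt.2 hij) ha hb
    · exact ⟨⟨le_rfl, fun _ _ hle => hle⟩, fun z hz => hz.1⟩
    · rwa [Finset.image_orderEmbOfFin_univ]
  have h1 := le_step θ (eNorm θ) x q _ hadm
  rw [← eNorm_eq] at h1
  have h2 : ∑ i : Fin G.card, eNorm θ (restrict (cell G (G.orderEmbOfFin rfl i)) x) =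
      ∑ g ∈ G, eNorm θ (restrict (cell G g) x) := by
    conv_rhs => rw [← Finset.image_orderEmbOfFin_univ G rfl]
    rw [Finset.sum_image fun i _ j _ hij => (G.orderEmbOfFin rfl).injective hij,
      Finset.image_orderEmbOfFin_univ]
  rw [h2] at h1
  have h3 := ENNReal.toReal_mono (eNorm_ne_top h x) h1
  rwa [ENNReal.toReal_mul, ENNReal.toReal_ofReal (h.pos q).le,
    ENNReal.toReal_sum fun _ _ => eNorm_ne_top h _] at h3

/-- The other half: each member of an admissible family lies in the cell that starts at its minimum,
so cells suffice for testing the norm. -/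
theorem nrm_le_of_forall_cellSum (h : IsRegular θ) {x : ℕ+ →₀ ℝ} {C : ℝ} (h0 : ∀ k, |x k| ≤ C)
    (hC : ∀ (q : ℕ+) (G : Finset ℕ+), G ∈ Schreier q → θ q * cellSum θ G x ≤ C) :
    nrm θ x ≤ C := by
  have hC0 : 0 ≤ C := (abs_nonneg _).trans (h0 1)
  refine ENNReal.toReal_le_of_le_ofReal hC0 ?_
  rw [eNorm_eq]
  refine sup_le (iSup_le fun k => ?_) ?_
  · rw [Real.enorm_eq_ofReal_abs]
    exact ENNReal.ofReal_le_ofReal (h0 k)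
  · refine iSup_le fun q => iSup_le fun n => iSup_le fun E => iSup_le fun hE => ?_
    obtain ⟨hlt, m, hm, hS⟩ := hE
    have hinj : Function.Injective m := by
      intro i j hij
      rcases lt_trichotomy i j with h1 | h1 | h1
      · exact absurd (hlt i j h1 _ (hm i).1 _ (hm j).1) (by rw [hij]; exact lt_irrefl _)
      · exact h1
      · exact absurd (hlt j i h1 _ (hm j).1 _ (hm i).1) (by rw [hij]; exact lt_irrefl _)
    have h1 := hC q _ hS
    rw [cellSum, Finset.sum_image fun i _ j _ hij => hinj hij] at h1
    have h2 : ∑ i, eNorm θ (restrict (E i) x) = ENNReal.ofReal (∑ i, nrm θ (restrict (E i) x)) := by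
      rw [ENNReal.ofReal_sum_of_nonneg fun _ _ => nrm_nonneg _]
      exact Finset.sum_congr rfl fun i _ => (ENNReal.ofReal_toReal (eNorm_ne_top h _)).symm
    rw [h2, ← ENNReal.ofReal_mul (h.pos q).le]
    refine ENNReal.ofReal_le_ofReal (le_trans ?_ h1)
    have hq := (h.pos q).le
    gcongr with i
    refine nrm_restrict_mono h fun k _ hk => ⟨(hm i).2 hk, ?_⟩
    intro g' hg' hle
    obtain ⟨i', -, rfl⟩ := Finset.mem_image.1 hg'
    rcases lt_trichotomy i i' with h1 | h1 | h1
    · exact absurd (hlt i i' h1 k hk _ (hm i').1) (not_lt.2 hle)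
    · rw [h1]
    · exact (hlt i' i h1 _ (hm i').1 _ (hm i).1).le

/-! ### Comparison of partitions -/

/-- A finite set can be trimmed to an interval that carries the vector. -/
theorem exists_trim (h : IsRegular θ) {a n : ℕ} {G K : Finset ℕ+} (hK : K ∈ Fam a n) {s t : ℕ+}
    (hGK : ∀ g ∈ G, (∃ z ∈ cell G g, s ≤ z ∧ z ≤ t) → g ∈ K) {x : ℕ+ →₀ ℝ}
    (hx : ∀ k ∈ x.support, s ≤ k ∧ k ≤ t) :
    ∃ G' ∈ Fam a n, (∀ g ∈ G', s ≤ g ∧ g ≤ t) ∧ cellSum θ G x ≤ cellSum θ G' x := by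
  classical
  set R := G.filter (fun g => ∃ z ∈ cell G g, s ≤ z ∧ z ≤ t) with hR
  have hmax : ∀ g ∈ R, max s g ∈ cell G g := by
    intro g hg
    obtain ⟨hg, z, hz, hsz, hzt⟩ := Finset.mem_filter.1 hg
    refine ⟨le_max_right _ _, fun g' hg' hle => ?_⟩
    exact hz.2 g' hg' (hle.trans (max_le hsz hz.1))
  have hRG : ∀ g ∈ R, g ∈ G := fun g hg => (Finset.mem_filter.1 hg).1
  have hinj : Set.InjOn (max s) (R : Set ℕ+) := by
    intro g hg g' hg' he
    have h1 := hmax g hg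
    rw [he] at h1
    exact mem_cell_unique (hRG g hg) (hRG g' hg') h1 (hmax g' hg')
  -- Among the points whose cells meet `[s, t]`, at most one lies left of `s`; it is moved up to
  -- `s`. Points only move to the right, so the Schreier order is kept.
  refine ⟨R.image (max s), ?_, ?_, ?_⟩
  · have hex : ∀ z : ℕ+, ∃ g : ℕ+, z ∈ R.image (max s) → g ∈ R ∧ max s g = z := by
      intro z
      by_cases hz : z ∈ R.image (max s)
      · obtain ⟨g, hg, he⟩ := Finset.mem_image.1 hz
        exact ⟨g, fun _ => ⟨hg, he⟩⟩
      · exact ⟨1, fun h => absurd h hz⟩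
    choose φ hφ using hex
    refine mem_fam_of_map φ hK ?_ ?_ ?_
    · intro z hz z' hz' hlt
      obtain ⟨h1, h2⟩ := hφ z hz
      obtain ⟨h3, h4⟩ := hφ z' hz'
      by_contra hle
      have := max_le_max (le_refl s) (not_lt.1 hle)
      rw [h2, h4] at this
      exact absurd hlt (not_lt.2 this)
    · intro z hz
      obtain ⟨h1, -⟩ := hφ z hz
      exact hGK _ (hRG _ h1) (Finset.mem_filter.1 h1).2
    · intro z hz
      obtain ⟨-, h2⟩ := hφ z hz
      exact (le_max_right _ _).trans_eq h2
  · intro g hg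
    obtain ⟨g, hgR, rfl⟩ := Finset.mem_image.1 hg
    obtain ⟨-, z, hz, hsz, hzt⟩ := Finset.mem_filter.1 hgR
    exact ⟨le_max_left _ _, max_le (hsz.trans hzt) (hz.1.trans hzt)⟩
  · rw [cellSum, cellSum, Finset.sum_image hinj,
      ← Finset.sum_subset (Finset.filter_subset _ _ : R ⊆ G)]
    · refine Finset.sum_le_sum fun g hg => nrm_restrict_mono h fun z hz hzg => ?_
      refine ⟨max_le (hx z hz).1 hzg.1, fun g' hg' hle => ?_⟩
      obtain ⟨g', hgR', rfl⟩ := Finset.mem_image.1 hg'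
      exact max_le_max le_rfl (hzg.2 g' (hRG g' hgR') ((le_max_right _ _).trans hle))
    · intro g hg hgR
      rw [restrict_eq_zero, nrm_zero]
      exact fun k hk hkg => hgR (Finset.mem_filter.2 ⟨hg, k, hkg, hx k hk⟩)

/-- For a vector supported beyond `n`, a union of `n` sets of order `a` can be trimmed to a single
set of order `a + 1`, at the price of the coefficient `θ_{a+1}`. -/
theorem mul_cellSum_le_of_mem_fam (h : IsRegular θ) {a n : ℕ} {G : Finset ℕ+} (hG : G ∈ Fam a n)
    {s : ℕ+} (hn : n ≤ (s : ℕ)) {x : ℕ+ →₀ ℝ} (hx : ∀ k ∈ x.support, s ≤ k) :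
    θ a.succPNat * cellSum θ G x ≤ nrm θ x := by
  obtain ⟨t, ht⟩ := x.support.bddAbove
  obtain ⟨G', h1, h2, h3⟩ := exists_trim h hG (s := s) (t := t) (fun g hg _ => hg)
    (fun k hk => ⟨hx k hk, ht hk⟩)
  refine (mul_le_mul_of_nonneg_left h3 (h.pos _).le).trans (mul_cellSum_le h ?_ x)
  exact mem_schreier_succ.2 ⟨n, h1, fun k hk => hn.trans (by exact_mod_cast (h2 k hk).1)⟩

/-- Partitions chosen separately inside the cells of `H` glue to one refined partition. This is what
makes iterated splittings a single splitting. -/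
theorem sum_cellSum_restrict_le (h : IsRegular θ) {H : Finset ℕ+} {G : ℕ+ → Finset ℕ+}
    (hG : ∀ g ∈ H, ∀ z ∈ G g, z ∈ cell H g) {W : ℕ+ → Set ℕ+} (hW : ∀ g ∈ H, W g ⊆ cell H g)
    (x : ℕ+ →₀ ℝ) :
    ∑ g ∈ H, cellSum θ (G g) (restrict (W g) x) ≤ cellSum θ (H.biUnion G) x := by
  have hdisj : Set.PairwiseDisjoint (H : Set ℕ+) G := by
    intro g hg g' hg' hne
    refine Finset.disjoint_left.2 fun z hz hz' => hne ?_
    exact mem_cell_unique hg hg' (hG g hg z hz) (hG g' hg' z hz')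
  conv_rhs => rw [cellSum, Finset.sum_biUnion hdisj]
  refine Finset.sum_le_sum fun g hg => Finset.sum_le_sum fun u hu => ?_
  rw [restrict_restrict]
  refine nrm_restrict_mono h fun z _ hz => ⟨hz.1.1, fun u' hu' hle => ?_⟩
  obtain ⟨g', hg', hu'⟩ := Finset.mem_biUnion.1 hu'
  rcases lt_trichotomy g g' with h1 | h1 | h1
  · exact absurd (lt_of_mem_cell hg' h1 (hW g hg hz.2) (hG g' hg' u' hu')) (not_lt.2 hle)
  · subst h1
    exact hz.1.2 u' hu' hle
  · exact (lt_of_mem_cell hg h1 (hG g' hg' u' hu') (hG g hg u hu)).le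

end Norm

/-! ### Normalized block sequences -/

/-- `(x_i)` is normalized and `x_i` is supported by the interval `[s_i, t_i]`, where
`s_0 ≤ t_0 < s_1 ≤ t_1 < ⋯`. -/
structure IsNormalizedBlock (θ : ℕ+ → ℝ) (x : ℕ → ℕ+ →₀ ℝ) (s t : ℕ → ℕ+) : Prop where
  le : ∀ i, s i ≤ t i
  lt : ∀ i, t i < s (i + 1)
  supp : ∀ i, ∀ k ∈ (x i).support, s i ≤ k ∧ k ≤ t i
  nrm_eq : ∀ i, nrm θ (x i) = 1

/-- The combination `∑_{i ∈ A} a_i x_i`. -/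
noncomputable def comb (a : ℕ → ℝ) (x : ℕ → ℕ+ →₀ ℝ) (A : Finset ℕ) : ℕ+ →₀ ℝ :=
  ∑ i ∈ A, a i • x i

/-- The `i ∈ A` for which `[s_i, t_i]` meets `G`. -/
noncomputable def broken (s t : ℕ → ℕ+) (G : Finset ℕ+) (A : Finset ℕ) : Finset ℕ :=
  open Classical in A.filter (fun i => ∃ g ∈ G, s i ≤ g ∧ g ≤ t i)

/-- The `i ∈ A` for which `[s_i, t_i]` does not meet `G` and lies in the interval of the
partition defined by `G` that starts at `g`. -/
noncomputable def inCell (s t : ℕ → ℕ+) (G : Finset ℕ+) (A : Finset ℕ) (g : ℕ+) : Finset ℕ :=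
  open Classical in A.filter (fun i => (¬ ∃ g ∈ G, s i ≤ g ∧ g ≤ t i) ∧ s i ∈ cell G g)

/-- The largest total weight of a subset `B` of `A` for which `{t_i : i ∈ B}` is a union of `n`
successive members of `S_r`. -/
noncomputable def err (t : ℕ → ℕ+) (a : ℕ → ℝ) (r n : ℕ) (A : Finset ℕ) : ℝ :=
  open Classical in
  (A.powerset.filter (fun B => B.image t ∈ Fam r n)).sup'
    ⟨∅, by simpa using empty_mem_fam r n⟩ (fun B => ∑ i ∈ B, a i)

theorem mem_broken {s t : ℕ → ℕ+} {G : Finset ℕ+} {A : Finset ℕ} {i : ℕ} :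
    i ∈ broken s t G A ↔ i ∈ A ∧ ∃ g ∈ G, s i ≤ g ∧ g ≤ t i := by
  classical
  unfold broken
  rw [Finset.mem_filter]

theorem mem_inCell {s t : ℕ → ℕ+} {G : Finset ℕ+} {A : Finset ℕ} {g : ℕ+} {i : ℕ} :
    i ∈ inCell s t G A g ↔ i ∈ A ∧ (¬ ∃ g ∈ G, s i ≤ g ∧ g ≤ t i) ∧ s i ∈ cell G g := by
  classical
  unfold inCell
  rw [Finset.mem_filter]

theorem inCell_subset {s t : ℕ → ℕ+} {G : Finset ℕ+} {A : Finset ℕ} {g : ℕ+} :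
    inCell s t G A g ⊆ A := fun _ hi => (mem_inCell.1 hi).1

theorem broken_subset {s t : ℕ → ℕ+} {G : Finset ℕ+} {A : Finset ℕ} :
    broken s t G A ⊆ A := fun _ hi => (mem_broken.1 hi).1

theorem mem_cell_of_mem_inCell {s t : ℕ → ℕ+} {G : Finset ℕ+} {A : Finset ℕ} {g : ℕ+} {i : ℕ}
    (hi : i ∈ inCell s t G A g) {z : ℕ+} (h1 : s i ≤ z) (h2 : z ≤ t i) : z ∈ cell G g := by
  obtain ⟨-, hb, hc⟩ := mem_inCell.1 hi
  refine ⟨hc.1.trans h1, fun g' hg' hle => hc.2 g' hg' ?_⟩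
  by_contra hlt
  exact hb ⟨g', hg', (not_le.1 hlt).le, hle.trans h2⟩

theorem sum_le_err {t : ℕ → ℕ+} {a : ℕ → ℝ} {r n : ℕ} {A B : Finset ℕ} (hBA : B ⊆ A)
    (hB : B.image t ∈ Fam r n) : ∑ i ∈ B, a i ≤ err t a r n A := by
  classical
  unfold err
  exact Finset.le_sup' (fun B => ∑ i ∈ B, a i)
    (Finset.mem_filter.2 ⟨Finset.mem_powerset.2 hBA, hB⟩)

theorem exists_eq_err (t : ℕ → ℕ+) (a : ℕ → ℝ) (r n : ℕ) (A : Finset ℕ) :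
    ∃ B ⊆ A, B.image t ∈ Fam r n ∧ err t a r n A = ∑ i ∈ B, a i := by
  classical
  unfold err
  obtain ⟨B, hB, he⟩ := Finset.exists_mem_eq_sup'
    (s := A.powerset.filter (fun B => B.image t ∈ Fam r n))
    ⟨∅, by simpa using empty_mem_fam r n⟩ (fun B => ∑ i ∈ B, a i)
  obtain ⟨h1, h2⟩ := Finset.mem_filter.1 hB
  exact ⟨B, Finset.mem_powerset.1 h1, h2, he⟩

theorem err_nonneg (t : ℕ → ℕ+) (a : ℕ → ℝ) (r n : ℕ) (A : Finset ℕ) : 0 ≤ err t a r n A := by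
  simpa using sum_le_err (t := t) (a := a) (r := r) (n := n) (Finset.empty_subset A)
    (by simpa using empty_mem_fam r n)

theorem err_mono {t : ℕ → ℕ+} {a : ℕ → ℝ} {r r' n n' : ℕ} (hr : r ≤ r') (hn : n ≤ n')
    (A : Finset ℕ) : err t a r n A ≤ err t a r' n' A := by
  obtain ⟨B, h1, h2, h3⟩ := exists_eq_err t a r n A
  rw [h3]
  exact sum_le_err h1 (fam_mono_left hr (fam_mono_right hn h2))

theorem le_err_of_mem {t : ℕ → ℕ+} {a : ℕ → ℝ} {r n : ℕ} {A : Finset ℕ} {i : ℕ} (hi : i ∈ A)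
    (hn : 1 ≤ n) : a i ≤ err t a r n A := by
  have := sum_le_err (t := t) (a := a) (r := r) (n := n) (Finset.singleton_subset_iff.2 hi)
    (fam_mono_right hn (mem_fam_one.2 (schreier_mono (Nat.zero_le r) (by simp [Schreier]))))
  simpa using this

section

variable {s t : ℕ → ℕ+}

/-- Choose a point of `G` in each cut interval `[s_i, t_i]`; moving it right to `t_i` keeps the
Schreier order. Hence the cut blocks have weight controlled by `err`. -/
theorem image_broken_mem_fam (hst : ∀ i, s i ≤ t i) (hts : ∀ i, t i < s (i + 1)) {r n : ℕ}
    {G : Finset ℕ+} (hG : G ∈ Fam r n) (A : Finset ℕ) : (broken s t G A).image t ∈ Fam r n := by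
  classical
  obtain ⟨-, ht⟩ := strictMono_of_interlaced hst hts
  have hex : ∀ i, ∃ g : ℕ+, i ∈ broken s t G A → g ∈ G ∧ s i ≤ g ∧ g ≤ t i := by
    intro i
    by_cases hi : i ∈ broken s t G A
    · obtain ⟨-, g, hg⟩ := mem_broken.1 hi
      exact ⟨g, fun _ => hg⟩
    · exact ⟨1, fun h => absurd h hi⟩
  choose γ hγ using hex
  have hinv : ∀ i, Function.invFun t (t i) = i := Function.leftInverse_invFun ht.injective
  refine mem_fam_of_map (fun z => γ (Function.invFun t z)) hG ?_ ?_ ?_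
  · intro x hx y hy hlt
    obtain ⟨i, hi, rfl⟩ := Finset.mem_image.1 hx
    obtain ⟨i', hi', rfl⟩ := Finset.mem_image.1 hy
    dsimp only
    rw [hinv, hinv]
    exact ((hγ i hi).2.2.trans_lt (lt_of_interlaced hst hts (ht.lt_iff_lt.1 hlt))).trans_le
      (hγ i' hi').2.1
  · intro x hx
    obtain ⟨i, hi, rfl⟩ := Finset.mem_image.1 hx
    rw [hinv]
    exact (hγ i hi).1
  · intro x hx
    obtain ⟨i, hi, rfl⟩ := Finset.mem_image.1 hx
    rw [hinv]
    exact (hγ i hi).2.2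

theorem inCell_disjoint {G : Finset ℕ+} (A : Finset ℕ) :
    Set.PairwiseDisjoint (G : Set ℕ+) (inCell s t G A) := by
  intro g hg g' hg' hne
  refine Finset.disjoint_left.2 fun i hi hi' => hne ?_
  exact mem_cell_unique hg hg' (mem_inCell.1 hi).2.2 (mem_inCell.1 hi').2.2

theorem sum_inCell_add_broken_le {a : ℕ → ℝ} (ha : ∀ i, 0 ≤ a i) (G : Finset ℕ+)
    (A : Finset ℕ) :
    ∑ g ∈ G, ∑ i ∈ inCell s t G A g, a i + ∑ i ∈ broken s t G A, a i ≤ ∑ i ∈ A, a i := by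
  rw [← Finset.sum_biUnion (inCell_disjoint A), ← Finset.sum_union]
  · refine Finset.sum_le_sum_of_subset_of_nonneg ?_ fun i _ _ => ha i
    refine Finset.union_subset (Finset.biUnion_subset.2 fun g _ => inCell_subset) broken_subset
  · refine Finset.disjoint_left.2 fun i hi hi' => ?_
    obtain ⟨g, -, hi⟩ := Finset.mem_biUnion.1 hi
    exact (mem_inCell.1 hi).2.1 (mem_broken.1 hi').2

/-- Optimal sets for the separate cells, joined together, have the composed Schreier order, so
errors add up over cells without loss of constants. -/
theorem sum_err_inCell_le (hst : ∀ i, s i ≤ t i) {a : ℕ → ℝ} {m r n n' : ℕ}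
    {G : Finset ℕ+} (hG : G ∈ Fam m n) (A : Finset ℕ) :
    ∑ g ∈ G, err t a r n' (inCell s t G A g) ≤ err t a (m + r) (n * n') A := by
  choose B h1 h2 h3 using fun g => exists_eq_err t a r n' (inCell s t G A g)
  simp only [h3]
  rw [← Finset.sum_biUnion fun g hg g' hg' hne =>
    (inCell_disjoint A hg hg' hne).mono (h1 g) (h1 g')]
  have hc : ∀ g, ∀ x ∈ (B g).image t, x ∈ cell G g := by
    intro g x hx
    obtain ⟨i, hi, rfl⟩ := Finset.mem_image.1 hx
    exact mem_cell_of_mem_inCell (h1 g hi) (hst i) le_rfl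
  refine sum_le_err (Finset.biUnion_subset.2 fun g _ => (h1 g).trans inCell_subset) ?_
  rw [Finset.biUnion_image]
  exact biUnion_mem_fam_mul hG _ (fun g _ => h2 g) (fun g _ x hx => (hc g x hx).1)
    fun g _ g' hg' hlt x hx y hy => lt_of_mem_cell hg' hlt (hc g x hx) (hc g' y hy)

end

/-! ### Norms and partition sums of combinations of a normalized block sequence -/

namespace IsNormalizedBlock

variable {θ : ℕ+ → ℝ} {x : ℕ → ℕ+ →₀ ℝ} {s t : ℕ → ℕ+}

theorem restrict_comb (hx : IsNormalizedBlock θ x s t) (a : ℕ → ℝ) {A' A : Finset ℕ}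
    (hA : A' ⊆ A) :
    restrict {z | ∃ i ∈ A', s i ≤ z ∧ z ≤ t i} (comb a x A) = comb a x A' := by
  unfold comb
  rw [restrict_sum, ← Finset.sum_subset hA]
  · refine Finset.sum_congr rfl fun i hi => ?_
    rw [restrict_smul, restrict_eq_self]
    exact fun k hk => ⟨i, hi, hx.supp i k hk⟩
  · intro i _ hi
    rw [restrict_smul, restrict_eq_zero, smul_zero]
    rintro k hk ⟨i', hi', hk'⟩
    have h1 := hx.supp i k hk
    rcases lt_trichotomy i i' with h | h | h
    · exact absurd (h1.2.trans_lt (lt_of_interlaced hx.le hx.lt h)) (not_lt.2 hk'.1)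
    · exact hi (h ▸ hi')
    · exact absurd (hk'.2.trans_lt (lt_of_interlaced hx.le hx.lt h)) (not_lt.2 h1.1)

theorem abs_comb_apply_le (hx : IsNormalizedBlock θ x s t) (h : IsRegular θ) {a : ℕ → ℝ}
    (ha : ∀ i, 0 ≤ a i) (A : Finset ℕ) {C : ℝ} (hC0 : 0 ≤ C) (hC : ∀ i ∈ A, a i ≤ C) (k : ℕ+) :
    |comb a x A k| ≤ C := by
  by_cases hk : ∃ i ∈ A, s i ≤ k ∧ k ≤ t i
  · obtain ⟨i, hi, hk⟩ := hk
    have h1 := congrArg (fun y => y k) (hx.restrict_comb a (Finset.singleton_subset_iff.2 hi))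
    rw [restrict_apply, if_pos ⟨i, by simp, hk⟩] at h1
    rw [h1]
    simp only [comb, Finset.sum_singleton, Finsupp.smul_apply, smul_eq_mul, abs_mul,
      abs_of_nonneg (ha i)]
    have h2 := abs_le_nrm h (x i) k
    rw [hx.nrm_eq] at h2
    exact (mul_le_of_le_one_right (ha i) h2).trans (hC i hi)
  · have h1 := congrArg (fun y => y k) (hx.restrict_comb a (Finset.Subset.refl A))
    rw [restrict_apply, if_neg (by exact hk)] at h1
    rw [← h1]
    simpa using hC0

theorem restrict_cell_comb (hx : IsNormalizedBlock θ x s t) (a : ℕ → ℝ) (G : Finset ℕ+)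
    (A : Finset ℕ) {g : ℕ+} (hg : g ∈ G) :
    restrict (cell G g) (comb a x (A \ broken s t G A)) = comb a x (inCell s t G A g) := by
  unfold comb
  have hsub : inCell s t G A g ⊆ A \ broken s t G A := fun i hi =>
    Finset.mem_sdiff.2 ⟨inCell_subset hi, fun hb => (mem_inCell.1 hi).2.1 (mem_broken.1 hb).2⟩
  rw [restrict_sum, ← Finset.sum_subset hsub]
  · refine Finset.sum_congr rfl fun i hi => ?_
    rw [restrict_smul, restrict_eq_self]
    intro k hk
    obtain ⟨h1, h2⟩ := hx.supp i k hk
    exact mem_cell_of_mem_inCell hi h1 h2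
  · intro i hi hni
    rw [restrict_smul, restrict_eq_zero, smul_zero]
    intro k hk hkc
    obtain ⟨hiA, hib⟩ := Finset.mem_sdiff.1 hi
    obtain ⟨h1, h2⟩ := hx.supp i k hk
    have hnb : ¬ ∃ g ∈ G, s i ≤ g ∧ g ≤ t i := fun hb => hib (mem_broken.2 ⟨hiA, hb⟩)
    refine hni (mem_inCell.2 ⟨hiA, hnb, ?_, fun g' hg' hle => hkc.2 g' hg' (hle.trans h1)⟩)
    by_contra hlt
    exact hnb ⟨g, hg, (not_le.1 hlt).le, hkc.1.trans h2⟩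

/-- The basic dichotomy: uncut blocks are grouped by the cell that contains them, and cut blocks are
estimated one at a time by the triangle inequality. -/
theorem cellSum_comb_le (hx : IsNormalizedBlock θ x s t) (h : IsRegular θ) {a : ℕ → ℝ}
    (ha : ∀ i, 0 ≤ a i) (G : Finset ℕ+) (A : Finset ℕ) :
    cellSum θ G (comb a x A) ≤ ∑ g ∈ G, nrm θ (comb a x (inCell s t G A g)) +
      ∑ i ∈ broken s t G A, a i * cellSum θ G (x i) := by
  have h1 : comb a x A = comb a x (A \ broken s t G A) + comb a x (broken s t G A) :=
    (Finset.sum_sdiff broken_subset).symm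
  rw [h1]
  refine (cellSum_add_le h _ _ _).trans (add_le_add (le_of_eq ?_) ?_)
  · exact Finset.sum_congr rfl fun g hg => by rw [hx.restrict_cell_comb a G A hg]
  · refine (cellSum_sum_le h _ _ _).trans (le_of_eq (Finset.sum_congr rfl fun i _ => ?_))
    rw [cellSum_smul, abs_of_nonneg (ha i)]

theorem nrm_comb_le (hx : IsNormalizedBlock θ x s t) (h : IsRegular θ) {a : ℕ → ℝ}
    (ha : ∀ i, 0 ≤ a i) (A : Finset ℕ) : nrm θ (comb a x A) ≤ ∑ i ∈ A, a i := by
  refine (nrm_sum_le h _ _).trans (le_of_eq (Finset.sum_congr rfl fun i _ => ?_))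
  rw [nrm_smul, abs_of_nonneg (ha i), hx.nrm_eq, mul_one]

theorem mul_sum_le_nrm_comb (hx : IsNormalizedBlock θ x s t) (h : IsRegular θ) {a : ℕ → ℝ}
    (ha : ∀ i, 0 ≤ a i) {q : ℕ+} {A : Finset ℕ} (hA : A.image s ∈ Schreier q) :
    θ q * ∑ i ∈ A, a i ≤ nrm θ (comb a x A) := by
  have hs := (strictMono_of_interlaced hx.le hx.lt).1
  refine le_trans (mul_le_mul_of_nonneg_left ?_ (h.pos q).le) (mul_cellSum_le h hA _)
  rw [cellSum, Finset.sum_image fun i _ j _ hij => hs.injective hij]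
  refine Finset.sum_le_sum fun i hi => ?_
  calc a i = nrm θ (comb a x {i}) := by
        simp [comb, nrm_smul, hx.nrm_eq, abs_of_nonneg (ha i)]
    _ ≤ _ := by
      rw [← hx.restrict_comb a (Finset.singleton_subset_iff.2 hi)]
      refine nrm_restrict_mono h fun k _ hk => ?_
      obtain ⟨i', hi', hk⟩ := hk
      rw [Finset.mem_singleton] at hi'
      subst hi'
      refine ⟨hk.1, fun g' hg' hle => ?_⟩
      obtain ⟨l, -, rfl⟩ := Finset.mem_image.1 hg'
      refine hs.monotone ?_
      by_contra hlt
      exact absurd (hk.2.trans_lt (lt_of_interlaced hx.le hx.lt (not_le.1 hlt))) (not_lt.2 hle)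

end IsNormalizedBlock

/-! ### The growth of `θ_n` -/

theorem rootLim_le_one {θ : ℕ+ → ℝ} (h : IsRegular θ) : rootLim θ ≤ 1 :=
  le_of_tendsto' (tendsto_rootLim h).1 fun n =>
    Real.rpow_le_one (h.pos n).le (h.lt_one n).le (by positivity)

/-- From some `N` on, `θ_n^{1/n} ≥ θ/σ`; the finitely many earlier terms are absorbed in `K =
1/θ_N`. -/
theorem exists_rootLim_pow_le {θ : ℕ+ → ℝ} (h : IsRegular θ) {σ : ℝ} (hσ : 1 < σ) :
    ∃ K, 0 < K ∧ ∀ n : ℕ+, rootLim θ ^ (n : ℕ) ≤ K * σ ^ (n : ℕ) * θ n := by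
  have hr := rootLim_pos h
  have hlt : rootLim θ / σ < rootLim θ := div_lt_self hr hσ
  obtain ⟨N, hN⟩ := eventually_atTop.1 ((tendsto_rootLim h).1.eventually (lt_mem_nhds hlt))
  have hσ0 : 0 < σ := by linarith
  refine ⟨1 / θ N, by have := h.pos N; positivity, fun n => ?_⟩
  have hn := h.pos n
  have hNp := h.pos N
  rcases le_total N n with hle | hle
  · have h1 := (hN n hle).le
    have h2 : (rootLim θ / σ) ^ (n : ℕ) ≤ θ n := by
      calc (rootLim θ / σ) ^ (n : ℕ) ≤ (θ n ^ (1 / (n : ℝ))) ^ (n : ℕ) := by gcongr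
        _ = θ n := by
          rw [← Real.rpow_natCast, ← Real.rpow_mul hn.le, one_div_mul_cancel, Real.rpow_one]
          exact_mod_cast n.ne_zero
    rw [div_pow, div_le_iff₀ (by positivity)] at h2
    calc rootLim θ ^ (n : ℕ) ≤ 1 * (θ n * σ ^ (n : ℕ)) := by rwa [one_mul]
      _ ≤ 1 / θ N * (θ n * σ ^ (n : ℕ)) := by
        gcongr
        rw [le_div_iff₀ hNp, one_mul]
        exact (h.lt_one N).le
      _ = _ := by ring
  · have h1 : θ N ≤ θ n := h.antitone hle
    calc rootLim θ ^ (n : ℕ) ≤ 1 := pow_le_one₀ hr.le (rootLim_le_one h)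
      _ ≤ σ ^ (n : ℕ) := one_le_pow₀ hσ.le
      _ = 1 / θ N * σ ^ (n : ℕ) * θ N := by field_simp
      _ ≤ _ := by gcongr

/-- Choosing `σ^M < ρ`, the sum is at most a constant times `(TM + 1) σ^{TM}`, which is negligible
against `ρ^T`. The shift to `θ_{b+1}` matches the order lost in `mul_cellSum_le_of_mem_fam`. -/
theorem exists_sum_rootLim_pow_le {θ : ℕ+ → ℝ} (h : IsRegular θ) (M : ℕ) {ρ : ℝ} (hρ : 1 < ρ) :
    ∃ T : ℕ, ∑ b ∈ Finset.range (T * M + 1), rootLim θ ^ b / θ b.succPNat ≤ ρ ^ T / 2 := by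
  have hr := rootLim_pos h
  obtain ⟨σ, hσ1, hσ⟩ : ∃ σ : ℝ, 1 < σ ∧ σ ^ M < ρ := by
    have : Tendsto (fun σ : ℝ => σ ^ M) (𝓝[>] 1) (𝓝 1) := by
      have h1 : ContinuousAt (fun σ : ℝ => σ ^ M) 1 := by fun_prop
      have h2 := h1.tendsto
      rw [one_pow] at h2
      exact h2.mono_left nhdsWithin_le_nhds
    obtain ⟨σ, h1, h2⟩ := ((this.eventually (gt_mem_nhds hρ)).and self_mem_nhdsWithin).exists
    exact ⟨σ, h2, h1⟩
  obtain ⟨K, hK0, hK⟩ := exists_rootLim_pow_le h hσ1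
  have hσ0 : 0 < σ := by linarith
  set K' := K * σ / rootLim θ with hK'
  have hK'0 : 0 < K' := by positivity
  have hterm : ∀ b : ℕ, rootLim θ ^ b / θ b.succPNat ≤ K' * σ ^ b := by
    intro b
    have h1 := hK b.succPNat
    rw [Nat.succPNat_coe] at h1
    rw [div_le_iff₀ (h.pos _), hK', ← mul_le_mul_iff_left₀ hr]
    calc rootLim θ ^ b * rootLim θ = rootLim θ ^ b.succ := (pow_succ _ _).symm
      _ ≤ _ := h1
      _ = _ := by rw [Nat.succ_eq_add_one, pow_succ]; field_simp
  have hc0 : 0 ≤ σ ^ M / ρ := by positivity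
  have hc1 : σ ^ M / ρ < 1 := (div_lt_one (by linarith)).2 hσ
  have hlim : Tendsto (fun T : ℕ => K' * (M * (T * (σ ^ M / ρ) ^ T) + (σ ^ M / ρ) ^ T))
      atTop (𝓝 (K' * (M * 0 + 0))) :=
    (((tendsto_self_mul_const_pow_of_lt_one hc0 hc1).const_mul _).add
      (tendsto_pow_atTop_nhds_zero_of_lt_one hc0 hc1)).const_mul _
  rw [mul_zero, add_zero, mul_zero] at hlim
  obtain ⟨T, hT⟩ := (hlim.eventually (gt_mem_nhds (by norm_num : (0 : ℝ) < 1 / 2))).exists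
  refine ⟨T, ?_⟩
  have hρT : 0 < ρ ^ T := by positivity
  calc ∑ b ∈ Finset.range (T * M + 1), rootLim θ ^ b / θ b.succPNat
      ≤ ∑ b ∈ Finset.range (T * M + 1), K' * σ ^ (T * M) := by
        refine Finset.sum_le_sum fun b hb => (hterm b).trans ?_
        have := Finset.mem_range.1 hb
        gcongr
        · exact hσ1.le
        · omega
    _ = ρ ^ T * (K' * (M * (T * (σ ^ M / ρ) ^ T) + (σ ^ M / ρ) ^ T)) := by
        rw [Finset.sum_const, Finset.card_range, nsmul_eq_mul, div_pow, ← pow_mul, mul_comm M T]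
        push_cast
        field_simp
    _ ≤ ρ ^ T * (1 / 2) := by gcongr
    _ = _ := by ring

/-! ### Vectors with small `ℓ_1`-sums over Schreier partitions -/

/-- Prepares a partition for gluing: its starting points are brought into the cell carrying `w`. -/
theorem exists_trim_cell {θ : ℕ+ → ℝ} (h : IsRegular θ) {a n : ℕ} {G H : Finset ℕ+}
    (hG : G ∈ Fam a n) {g : ℕ+} {w : ℕ+ →₀ ℝ} (hw : ∀ k ∈ w.support, k ∈ cell H g) :
    ∃ G' ∈ Fam a n, (∀ z ∈ G', z ∈ cell H g) ∧ cellSum θ G w ≤ cellSum θ G' w := by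
  rcases w.support.eq_empty_or_nonempty with h0 | h0
  · refine ⟨∅, empty_mem_fam a n, by simp, ?_⟩
    rw [Finsupp.support_eq_empty.1 h0]
    simp [cellSum, restrict_zero, nrm_zero]
  · obtain ⟨G', h1, h2, h3⟩ := exists_trim h hG (s := g) (t := w.support.max' h0)
      (fun g hg _ => hg) (fun k hk => ⟨(hw k hk).1, Finset.le_max' _ k hk⟩)
    refine ⟨G', h1, fun z hz => ⟨(h2 z hz).1, fun g' hg' hle => ?_⟩, h3⟩
    exact (hw _ (Finset.max'_mem _ h0)).2 g' hg' (hle.trans (h2 z hz).2)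

theorem cell_singleton_one : cell {1} 1 = Set.univ := by
  ext z
  simp [cell]

namespace IsNormalizedBlock

variable {θ : ℕ+ → ℝ} {x : ℕ → ℕ+ →₀ ℝ} {s t : ℕ → ℕ+}

/-- If every combination can be split with a gain, then the gains accumulate. -/
theorem iterate_splitting (hx : IsNormalizedBlock θ x s t) (h : IsRegular θ) {a : ℕ → ℝ}
    (ha : ∀ i, 0 ≤ a i) {F : Finset ℕ} {n M : ℕ} {ρ K : ℝ} (hn : 1 ≤ n) (hρ : 1 ≤ ρ) (hK : 0 ≤ K)
    (hbound : ∀ i ∈ F, ∀ m ≤ M, ∀ H ∈ Fam m n, cellSum θ H (x i) ≤ K)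
    (hbad : ∀ A ⊆ F, A.Nonempty → ∃ m ≤ M, ∃ H ∈ Fam m n,
      ρ * nrm θ (comb a x A) < rootLim θ ^ m * cellSum θ H (comb a x A)) (T : ℕ) :
    ∀ A ⊆ F, ∃ G : ℕ → Finset ℕ+, (∀ b, G b ∈ Fam b (n ^ T)) ∧
      ρ ^ T * nrm θ (comb a x A) ≤
        ∑ b ∈ Finset.range (T * M + 1), rootLim θ ^ b * cellSum θ (G b) (comb a x A) +
          T * ρ ^ T * K * err t a (T * M) (n ^ T) A := by
  have hr := rootLim_pos h
  have hr1 := rootLim_le_one h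
  induction T with
  | zero =>
    intro A _
    -- The trivial partition: its only cell is everything, so the sum over it is the norm.
    refine ⟨fun _ => {1}, fun b => ?_, ?_⟩
    · exact mem_fam_one.2 (schreier_mono (Nat.zero_le b) (by simp [Schreier]))
    · simp [cellSum, cell_singleton_one, restrict_eq_self]
  | succ T ih =>
    intro A hA
    rcases A.eq_empty_or_nonempty with rfl | hne
    · refine ⟨fun _ => ∅, fun b => empty_mem_fam _ _, ?_⟩
      have := err_nonneg t a ((T + 1) * M) (n ^ (T + 1)) ∅
      simp only [comb, Finset.sum_empty, nrm_zero, mul_zero, cellSum, Finset.sum_const_zero,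
        zero_add]
      positivity
    obtain ⟨m, hm, H, hH, hlt⟩ := hbad A hA hne
    choose G hG1 hG2 using fun g => ih (inCell s t H A g) (inCell_subset.trans hA)
    have hrest : ∀ g, restrict {z | ∃ i ∈ inCell s t H A g, s i ≤ z ∧ z ≤ t i} (comb a x A) =
        comb a x (inCell s t H A g) := fun g => hx.restrict_comb a inCell_subset
    have hW : ∀ g, {z | ∃ i ∈ inCell s t H A g, s i ≤ z ∧ z ≤ t i} ⊆ cell H g := by
      rintro g z ⟨i, hi, h1, h2⟩
      exact mem_cell_of_mem_inCell hi h1 h2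
    have hsup : ∀ g, ∀ k ∈ (comb a x (inCell s t H A g)).support, k ∈ cell H g := by
      intro g k hk
      rw [← hrest, Finsupp.mem_support_iff, restrict_apply] at hk
      by_contra hkc
      exact hk (if_neg fun hkW => hkc (hW g hkW))
    choose G' hG'1 hG'2 hG'3 using fun g b => exists_trim_cell h (hG1 g b) (hsup g)
    have hcs : ∀ b, H.biUnion (fun g => G' g b) ∈ Fam (m + b) (n ^ (T + 1)) := by
      intro b
      rw [pow_succ, mul_comm]
      exact biUnion_mem_fam_mul hH _ (fun g _ => hG'1 g b)
        (fun g _ z hz => (hG'2 g b z hz).1)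
        fun g _ g' hg' hlt z hz z' hz' => lt_of_mem_cell hg' hlt (hG'2 g b z hz) (hG'2 g' b z' hz')
    -- Splitting by `H` raises all orders by `m`, so the new partition of order `b` is glued from
    -- those of order `b - m`. The orders may differ from cell to cell, which is why the induction
    -- carries a sum over all `b`.
    refine ⟨fun b => if m ≤ b then H.biUnion (fun g => G' g (b - m)) else ∅, fun b => ?_, ?_⟩
    · dsimp only
      split_ifs with hmb
      · have := hcs (b - m)
        rwa [Nat.add_sub_cancel' hmb] at this
      · exact empty_mem_fam _ _
    have hE0 := err_nonneg t a ((T + 1) * M) (n ^ (T + 1)) A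
    set E := err t a ((T + 1) * M) (n ^ (T + 1)) A with hE
    have hρT : 0 ≤ ρ ^ T := by positivity
    have hrm : 0 ≤ rootLim θ ^ m := by positivity
    have hrm1 : rootLim θ ^ m ≤ 1 := pow_le_one₀ hr.le hr1
    have hTm : m + T * M ≤ (T + 1) * M := by rw [Nat.succ_mul]; omega
    -- The price of one round: blocks cut by `H` are discarded, each costing at most `K`. After `T`
    -- rounds this accounts for the factor `T` of the error term.
    have e1 : ∑ i ∈ broken s t H A, a i * cellSum θ H (x i) ≤ K * E := by
      calc _ ≤ ∑ i ∈ broken s t H A, a i * K := by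
            refine Finset.sum_le_sum fun i hi => mul_le_mul_of_nonneg_left ?_ (ha i)
            exact hbound i (hA (broken_subset hi)) m hm H hH
        _ = K * ∑ i ∈ broken s t H A, a i := by rw [← Finset.sum_mul, mul_comm]
        _ ≤ K * E := by
          refine mul_le_mul_of_nonneg_left ?_ hK
          refine sum_le_err broken_subset (image_broken_mem_fam hx.le hx.lt ?_ A)
          refine fam_mono_left (by omega) (fam_mono_right ?_ hH)
          simpa using Nat.pow_le_pow_right hn (Nat.le_add_left 1 T)
    have e2 : ∑ g ∈ H, err t a (T * M) (n ^ T) (inCell s t H A g) ≤ E := by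
      refine (sum_err_inCell_le hx.le hH A).trans (err_mono hTm (le_of_eq ?_) A)
      rw [pow_succ, mul_comm]
    have e3 : ∑ g ∈ H, ∑ b ∈ Finset.range (T * M + 1),
        rootLim θ ^ b * cellSum θ (G g b) (comb a x (inCell s t H A g)) ≤
        ∑ b ∈ Finset.range (T * M + 1),
          rootLim θ ^ b * cellSum θ (H.biUnion (fun g => G' g b)) (comb a x A) := by
      rw [Finset.sum_comm]
      refine Finset.sum_le_sum fun b _ => ?_
      rw [← Finset.mul_sum]
      refine mul_le_mul_of_nonneg_left ?_ (by positivity)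
      refine le_trans (Finset.sum_le_sum fun g _ => hG'3 g b) ?_
      simp only [← hrest]
      exact sum_cellSum_restrict_le h (fun g _ => hG'2 g b) (fun g _ => hW g) _
    have e4 : rootLim θ ^ m * ∑ b ∈ Finset.range (T * M + 1),
          rootLim θ ^ b * cellSum θ (H.biUnion (fun g => G' g b)) (comb a x A) ≤
        ∑ b ∈ Finset.range ((T + 1) * M + 1), rootLim θ ^ b *
          cellSum θ (if m ≤ b then H.biUnion (fun g => G' g (b - m)) else ∅) (comb a x A) := by
      have hinj : Set.InjOn (fun b => m + b) (Finset.range (T * M + 1) : Set ℕ) :=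
        fun b _ b' _ hb => Nat.add_left_cancel hb
      calc _ = ∑ b ∈ (Finset.range (T * M + 1)).image (fun b => m + b), rootLim θ ^ b *
          cellSum θ (if m ≤ b then H.biUnion (fun g => G' g (b - m)) else ∅) (comb a x A) := by
            rw [Finset.sum_image hinj, Finset.mul_sum]
            refine Finset.sum_congr rfl fun b _ => ?_
            rw [if_pos (Nat.le_add_right m b), Nat.add_sub_cancel_left, pow_add, mul_assoc]
        _ ≤ _ := by
            refine Finset.sum_le_sum_of_subset_of_nonneg ?_ fun b _ _ =>
              mul_nonneg (by positivity) (cellSum_nonneg _ _)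
            intro b hb
            obtain ⟨b', hb', rfl⟩ := Finset.mem_image.1 hb
            rw [Finset.mem_range] at hb' ⊢
            omega
    have e5 := hx.cellSum_comb_le h ha H A
    have e6 : ρ ^ T * ∑ g ∈ H, nrm θ (comb a x (inCell s t H A g)) ≤
        ∑ b ∈ Finset.range (T * M + 1),
          rootLim θ ^ b * cellSum θ (H.biUnion (fun g => G' g b)) (comb a x A) +
        T * ρ ^ T * K * E := by
      rw [Finset.mul_sum]
      refine (Finset.sum_le_sum fun g _ => hG2 g).trans ?_
      rw [Finset.sum_add_distrib, ← Finset.mul_sum]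
      gcongr
    set S := ∑ b ∈ Finset.range (T * M + 1),
          rootLim θ ^ b * cellSum θ (H.biUnion (fun g => G' g b)) (comb a x A) with hS
    refine le_trans ?_ (add_le_add_left e4 _)
    have hT0 : 0 ≤ T * ρ ^ T * K * E := by positivity
    have hK0 : 0 ≤ ρ ^ T * (K * E) := by positivity
    calc ρ ^ (T + 1) * nrm θ (comb a x A) = ρ ^ T * (ρ * nrm θ (comb a x A)) := by ring
      _ ≤ ρ ^ T * (rootLim θ ^ m * cellSum θ H (comb a x A)) := by gcongr
      _ ≤ ρ ^ T * (rootLim θ ^ m * (∑ g ∈ H, nrm θ (comb a x (inCell s t H A g)) + K * E)) := by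
          have := e5.trans (add_le_add_right e1 _)
          gcongr
      _ = rootLim θ ^ m * (ρ ^ T * ∑ g ∈ H, nrm θ (comb a x (inCell s t H A g))) +
          rootLim θ ^ m * (ρ ^ T * (K * E)) := by ring
      _ ≤ rootLim θ ^ m * (S + T * ρ ^ T * K * E) + 1 * (ρ ^ T * (K * E)) := by gcongr
      _ = rootLim θ ^ m * S + rootLim θ ^ m * (T * ρ ^ T * K * E) + ρ ^ T * (K * E) := by ring
      _ ≤ rootLim θ ^ m * S + 1 * (T * ρ ^ T * K * E) + ρ ^ T * (K * E) := by gcongr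
      _ = rootLim θ ^ m * S + (T + 1) * ρ ^ T * K * E := by ring
      _ ≤ rootLim θ ^ m * S + (T + 1) * ρ ^ (T + 1) * K * E := by
          gcongr
          omega
      _ = _ := by push_cast; ring

theorem exists_small_cellSum (hx : IsNormalizedBlock θ x s t) (h : IsRegular θ) {n : ℕ}
    (hn : 1 ≤ n) (M : ℕ) {ρ : ℝ} (hρ : 1 < ρ) :
    ∃ (A : Finset ℕ) (a : ℕ → ℝ), A.Nonempty ∧ (∀ i ∈ A, 0 < a i) ∧
      ∀ m ≤ M, ∀ H ∈ Fam m n,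
        rootLim θ ^ m * cellSum θ H (comb a x A) ≤ ρ * nrm θ (comb a x A) := by
  obtain ⟨T, hT⟩ := exists_sum_rootLim_pow_le h M hρ
  have hs := (strictMono_of_interlaced hx.le hx.lt).1
  -- The error involves `n^T` sets of order `T M`, which far out form one set of order `T M + 1`;
  -- the average must therefore have order `T M + 2`.
  set q : ℕ+ := (T * M + 1).succPNat with hq
  have hqc : (q : ℕ) = T * M + 2 := rfl
  set K := 1 / θ M.succPNat with hKdef
  have hK0 : 0 < K := one_div_pos.2 (h.pos _)
  have hθq := h.pos q
  -- The tolerance makes the accumulated error `T ρ^T K · err` at most `ρ^T θ_q / 4`, while the norm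
  -- of the average is at least `θ_q`. Starting at `n^(T+1)` keeps every family that occurs
  -- admissible one order higher.
  obtain ⟨F, a, h1, h2, h3, h4, h5, h6, h7⟩ :=
    exists_average hx.le hx.lt q (ε := θ q / (4 * (T + 1) * K)) (by positivity) (n ^ (T + 1))
  by_contra! hcon
  have hsi : ∀ i ∈ F, n ^ (T + 1) ≤ (s i : ℕ) := fun i hi =>
    (h1 i hi).trans (le_coe_of_strictMono hs i)
  have hpn : n ≤ n ^ (T + 1) := by simpa using Nat.pow_le_pow_right hn (Nat.le_add_left 1 T)
  have hpT : n ^ T ≤ n ^ (T + 1) := Nat.pow_le_pow_right hn (Nat.le_succ T)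
  obtain ⟨G, hG1, hG2⟩ := hx.iterate_splitting h h2 (F := F) (n := n) (M := M) (ρ := ρ) (K := K)
    hn hρ.le hK0.le (fun i hi m hm H hH => by
      have e1 := mul_cellSum_le_of_mem_fam h hH (hpn.trans (hsi i hi))
        (fun k hk => (hx.supp i k hk).1)
      rw [hx.nrm_eq] at e1
      have e2 : θ M.succPNat ≤ θ m.succPNat := h.antitone (Nat.succPNat_le_succPNat.2 hm)
      rw [hKdef, le_div_iff₀ (h.pos _), mul_comm]
      exact (mul_le_mul_of_nonneg_right e2 (cellSum_nonneg _ _)).trans e1)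
    (fun A hA hne => by
      obtain ⟨m, hm, H, hH, hlt⟩ := hcon A a hne (fun i hi => h3 i (hA hi))
      exact ⟨m, hm, H, hH, hlt⟩) T F (Finset.Subset.refl F)
  set N := nrm θ (comb a x F) with hN
  have hN0 : 0 ≤ N := nrm_nonneg _
  have hlow : θ q ≤ N := by
    have := hx.mul_sum_le_nrm_comb h h2 h6
    rwa [h5, mul_one] at this
  have hsupp : ∀ k ∈ (comb a x F).support, (⟨n ^ (T + 1), by positivity⟩ : ℕ+) ≤ k := by
    intro k hk
    rw [← hx.restrict_comb a (Finset.Subset.refl F), Finsupp.mem_support_iff, restrict_apply] at hk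
    have : ∃ i ∈ F, s i ≤ k ∧ k ≤ t i := by
      by_contra hk'
      exact hk (if_neg hk')
    obtain ⟨i, hi, hik, -⟩ := this
    exact (show n ^ (T + 1) ≤ (k : ℕ) from (hsi i hi).trans (by exact_mod_cast hik))
  have hsum : ∑ b ∈ Finset.range (T * M + 1), rootLim θ ^ b * cellSum θ (G b) (comb a x F) ≤
      ρ ^ T / 2 * N := by
    refine le_trans ?_ (mul_le_mul_of_nonneg_right hT hN0)
    rw [Finset.sum_mul]
    refine Finset.sum_le_sum fun b _ => ?_
    have e1 := mul_cellSum_le_of_mem_fam h (hG1 b) (by exact hpT) hsupp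
    have hb := h.pos b.succPNat
    have hr := rootLim_pos h
    rw [div_mul_eq_mul_div, le_div_iff₀ hb, mul_assoc]
    gcongr
    rwa [mul_comm]
  have herr : err t a (T * M) (n ^ T) F ≤ θ q / (4 * (T + 1) * K) := by
    obtain ⟨B, b1, b2, b3⟩ := exists_eq_err t a (T * M) (n ^ T) F
    rw [b3]
    refine h7 (T * M + 1) (by omega) B (mem_schreier_succ.2 ⟨n ^ T, b2, fun k hk => ?_⟩)
    obtain ⟨i, hi, rfl⟩ := Finset.mem_image.1 hk
    exact hpT.trans ((hsi i (b1 hi)).trans (by exact_mod_cast hx.le i))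
  have hρT : 0 < ρ ^ T := by positivity
  have e2 : ρ ^ T * N ≤ ρ ^ T * (N / 2 + θ q / 4) := by
    calc ρ ^ T * N ≤ ρ ^ T / 2 * N + T * ρ ^ T * K * (θ q / (4 * (T + 1) * K)) := by
          refine hG2.trans (add_le_add hsum ?_)
          gcongr
      _ ≤ ρ ^ T / 2 * N + (T + 1) * ρ ^ T * K * (θ q / (4 * (T + 1) * K)) := by
          gcongr
          linarith
      _ = _ := by field_simp
  -- Now `N ≤ N/2 + θ_q/4` contradicts `N ≥ θ_q > 0`.
  have e3 := le_of_mul_le_mul_left e2 hρT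
  linarith

end IsNormalizedBlock

/-! ### The upper estimate for averages of well-chosen vectors -/

namespace IsNormalizedBlock

variable {θ : ℕ+ → ℝ} {x : ℕ → ℕ+ →₀ ℝ} {s t : ℕ → ℕ+}

/-- A crude bound uniform in `G`; it is used when `θ_q` is so small that even the product with `t_i`
is negligible. -/
theorem cellSum_le_coe (hx : IsNormalizedBlock θ x s t) (h : IsRegular θ) (G : Finset ℕ+)
    (i : ℕ) : cellSum θ G (x i) ≤ (t i : ℕ) := by
  refine (cellSum_le_sum_abs h G (x i)).trans ?_
  have hsub : (x i).support ⊆ Finset.Icc 1 (t i) := fun k hk =>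
    Finset.mem_Icc.2 ⟨one_le, (hx.supp i k hk).2⟩
  calc ∑ k ∈ (x i).support, |x i k| ≤ ∑ k ∈ (x i).support, 1 := by
        refine Finset.sum_le_sum fun k _ => ?_
        rw [← hx.nrm_eq i]
        exact abs_le_nrm h _ k
    _ = (x i).support.card := by simp
    _ ≤ (t i : ℕ) := by
      have := Finset.card_le_card hsub
      rw [PNat.card_Icc] at this
      exact_mod_cast this.trans (by simp)

/-- The sums over a member of `S_{d+m+1}` are controlled by sums over unions of few members
of `S_m`, unless the support meets a set of coarse division points. -/
theorem exists_fam_of_notMem_broken (hx : IsNormalizedBlock θ x s t) (h : IsRegular θ) {d m : ℕ}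
    {G : Finset ℕ+} (hG : G ∈ Schreier (d + (m + 1))) :
    ∃ U ∈ Schreier d, ∀ i, (¬ ∃ u ∈ U, s i ≤ u ∧ u ≤ t i) →
      ∃ H ∈ Fam m (s i), cellSum θ G (x i) ≤ cellSum θ H (x i) := by
  obtain ⟨U, hUG, hU, hmin, hcell⟩ := exists_schreier_decomposition hG
  refine ⟨U, hU, fun i hi => ?_⟩
  suffices hK : ∃ K ∈ Fam m (s i), ∀ g ∈ G, (∃ z ∈ cell G g, s i ≤ z ∧ z ≤ t i) → g ∈ K by
    obtain ⟨K, hK, hGK⟩ := hK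
    obtain ⟨H, h1, -, h2⟩ := exists_trim h hK hGK (hx.supp i)
    exact ⟨H, h1, h2⟩
  by_cases hu : ∃ u ∈ U, u ≤ s i
  · obtain ⟨u₀, hu₀, hle₀⟩ := hu
    obtain ⟨u, hu, -, hsu⟩ := exists_mem_cell hu₀ hle₀
    obtain ⟨K, hK, hKu⟩ := hcell u hu
    obtain ⟨n, hn1, hn2⟩ := mem_schreier_succ.1 hK
    have huK : u ∈ K := hKu u (hUG hu) ⟨le_rfl, fun _ _ hle => hle⟩
    -- `K` has order `m + 1` and contains `u ≤ s_i`, so it consists of at most `s_i` sets of order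
    -- `m`; as no coarse division point lies in `[s_i, t_i]`, the points of `G` relevant to `x_i`
    -- all lie in `K`.
    refine ⟨K, fam_mono_right ((hn2 u huK).trans (by exact_mod_cast hsu.1)) hn1, ?_⟩
    rintro g hg ⟨z, hz, hsz, hzt⟩
    refine hKu g hg ⟨hz.2 u (hUG hu) (hsu.1.trans hsz), fun u' hu' hle => hsu.2 u' hu' ?_⟩
    by_contra hlt
    exact hi ⟨u', hu', (not_le.1 hlt).le, (hle.trans hz.1).trans hzt⟩
  · push Not at hu
    -- All coarse points lie to the right of `x_i`, hence so do all points of `G`, and no cell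
    -- reaches `x_i`.
    refine ⟨∅, empty_mem_fam _ _, ?_⟩
    rintro g hg ⟨z, hz, hsz, hzt⟩
    obtain ⟨u, hu', hle⟩ := hmin g hg
    exact absurd ⟨u, hu', (hu u hu').le, (hle.trans hz.1).trans hzt⟩ hi

/-- Here `l` is the total order of the splittings made so far, `Θ` the product of their
coefficients, and `d = j - l - 1` the largest order that keeps the total below `j`. A splitting of
order `q ≤ d` leads to the same estimate with `d - q`; one of order `q > d` ends the recursion,
because the total order is then `j + m` and `Θ θ_q ≤ C θ^m`. The factor `d + 2` pays one error for
each nonterminal splitting and two for the terminal one. -/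
theorem mul_nrm_comb_le (hx : IsNormalizedBlock θ x s t) (h : IsRegular θ) {a : ℕ → ℝ}
    (ha : ∀ i, 0 ≤ a i) {η C : ℝ} (hη : 0 ≤ η) (hC : 0 ≤ C) {j : ℕ} {M : ℕ → ℕ}
    (hgood : ∀ i, ∀ m ≤ M i, ∀ H ∈ Fam m (s i), rootLim θ ^ m * cellSum θ H (x i) ≤ 1 + η)
    (hM : ∀ i i', i < i' → ∀ q : ℕ+, M i' ≤ q → θ q * (t i : ℕ) ≤ η)
    (hθC : ∀ (p : ℕ+) (m : ℕ), (p : ℕ) = j + m → θ p ≤ C * rootLim θ ^ m) (d : ℕ) :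
    ∀ l : ℕ, l + d + 1 = j → ∀ Θ : ℝ, 0 < Θ → Θ ≤ 1 →
      (∀ q p : ℕ+, (p : ℕ) = l + q → Θ * θ q ≤ θ p) → ∀ A : Finset ℕ,
      Θ * nrm θ (comb a x A) ≤ ((1 + η) * C + η) * ∑ i ∈ A, a i + (d + 2) * err t a d 1 A := by
  classical
  have hr := rootLim_pos h
  have hr1 := rootLim_le_one h
  induction d using Nat.strong_induction_on with
  | _ d ih =>
  intro l hl Θ hΘ hΘ1 hΘq A
  set D := (1 + η) * C + η with hD
  have hCD : C ≤ D := by nlinarith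
  have hD0 : 0 ≤ D := hC.trans hCD
  have hsum0 : 0 ≤ ∑ i ∈ A, a i := Finset.sum_nonneg fun i _ => ha i
  have herr0 := err_nonneg t a d 1 A
  set R := D * ∑ i ∈ A, a i + (d + 2) * err t a d 1 A with hR
  have herrR : err t a d 1 A ≤ R := by
    have : 0 ≤ (d : ℝ) * err t a d 1 A := by positivity
    nlinarith [mul_nonneg hD0 hsum0]
  rw [mul_comm, ← le_div_iff₀ hΘ]
  refine nrm_le_of_forall_cellSum h (fun k => ?_) fun q G hG => ?_
  · rw [le_div_iff₀ hΘ]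
    have h1 := hx.abs_comb_apply_le h ha A herr0 (fun i hi => le_err_of_mem hi le_rfl) k
    exact (mul_le_of_le_one_right (abs_nonneg _) hΘ1).trans (h1.trans herrR)
  rw [le_div_iff₀ hΘ]
  have hq := h.pos q
  have e1 := hx.cellSum_comb_le h ha G A
  have hval : ∀ i, Θ * θ q * cellSum θ G (x i) ≤ 1 := fun i => by
    have h1 := mul_cellSum_le h hG (x i)
    rw [hx.nrm_eq] at h1
    rw [mul_assoc]
    exact mul_le_one₀ hΘ1 (mul_nonneg hq.le (cellSum_nonneg _ _)) h1
  have e2 : θ q * cellSum θ G (comb a x A) * Θ ≤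
      ∑ g ∈ G, Θ * θ q * nrm θ (comb a x (inCell s t G A g)) +
      ∑ i ∈ broken s t G A, a i * (Θ * θ q * cellSum θ G (x i)) := by
    calc θ q * cellSum θ G (comb a x A) * Θ = Θ * θ q * cellSum θ G (comb a x A) := by ring
      _ ≤ Θ * θ q * _ := mul_le_mul_of_nonneg_left e1 (by positivity)
      _ = _ := by
        rw [mul_add, Finset.mul_sum, Finset.mul_sum]
        congr 1
        exact Finset.sum_congr rfl fun i _ => by ring
  refine e2.trans ?_
  have e3 := sum_inCell_add_broken_le (s := s) (t := t) ha G A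
  have hb0 : 0 ≤ ∑ i ∈ broken s t G A, a i := Finset.sum_nonneg fun i _ => ha i
  by_cases hqd : (q : ℕ) ≤ d
  · have hq1 : 1 ≤ (q : ℕ) := q.pos
    have e4 : ∀ g ∈ G, Θ * θ q * nrm θ (comb a x (inCell s t G A g)) ≤
        D * ∑ i ∈ inCell s t G A g, a i +
          ((d - q : ℕ) + 2) * err t a (d - q) 1 (inCell s t G A g) := fun g _ => by
      refine ih (d - q) (by omega) (l + q) (by omega) (Θ * θ q) (by positivity)
        (mul_le_one₀ hΘ1 hq.le (h.lt_one q).le) (fun q' p hp => ?_) _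
      refine le_trans ?_ (hΘq (q + q') p (by rw [PNat.add_coe]; omega))
      rw [mul_assoc]
      exact mul_le_mul_of_nonneg_left (h.mul_le q q') hΘ.le
    have e5 : ∑ g ∈ G, err t a (d - q) 1 (inCell s t G A g) ≤ err t a d 1 A := by
      refine (sum_err_inCell_le hx.le (mem_fam_one.2 hG) A).trans (le_of_eq ?_)
      rw [Nat.add_sub_cancel' hqd]
    have e6 : ∑ i ∈ broken s t G A, a i * (Θ * θ q * cellSum θ G (x i)) ≤ err t a d 1 A := by
      refine le_trans (Finset.sum_le_sum fun i _ => mul_le_of_le_one_right (ha i) (hval i)) ?_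
      exact sum_le_err broken_subset
        (fam_mono_left hqd (image_broken_mem_fam hx.le hx.lt (mem_fam_one.2 hG) A))
    have e7 : ∑ g ∈ G, Θ * θ q * nrm θ (comb a x (inCell s t G A g)) ≤
        D * ∑ g ∈ G, ∑ i ∈ inCell s t G A g, a i +
          ((d - q : ℕ) + 2) * ∑ g ∈ G, err t a (d - q) 1 (inCell s t G A g) := by
      refine (Finset.sum_le_sum e4).trans (le_of_eq ?_)
      rw [Finset.sum_add_distrib, ← Finset.mul_sum, ← Finset.mul_sum]
    have hdq : ((d - q : ℕ) : ℝ) + 1 ≤ d := by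
      exact_mod_cast (by omega : d - q + 1 ≤ d)
    have e8 : (((d - q : ℕ) : ℝ) + 2) * ∑ g ∈ G, err t a (d - q) 1 (inCell s t G A g) ≤
        (d + 1) * err t a d 1 A :=
      mul_le_mul (by linarith) e5 (Finset.sum_nonneg fun g _ => err_nonneg _ _ _ _ _)
        (by positivity)
    have e9 : D * ∑ g ∈ G, ∑ i ∈ inCell s t G A g, a i ≤ D * ∑ i ∈ A, a i :=
      mul_le_mul_of_nonneg_left (by linarith) hD0
    rw [hR]
    linarith
  -- Terminal case: `m = q - d - 1` is the surplus order, and `l + q = j + m`.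
  · obtain ⟨m, hm⟩ : ∃ m, (q : ℕ) = d + (m + 1) := ⟨q - d - 1, by omega⟩
    have hθp : Θ * θ q ≤ C * rootLim θ ^ m :=
      (hΘq q ⟨l + q, by positivity⟩ rfl).trans (hθC _ m (by simp only [PNat.mk_coe]; omega))
    have hθC' : Θ * θ q ≤ C := hθp.trans (mul_le_of_le_one_right hC (pow_le_one₀ hr.le hr1))
    rw [hm] at hG
    obtain ⟨U, hU, hUi⟩ := hx.exists_fam_of_notMem_broken h hG
    -- If `m` exceeds `M i`, the goodness of `x_i` gives nothing. If a later `M i'` is also below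
    -- `m`, then `θ_q t_i ≤ η`; so only the last such `i` is exceptional, and a single coefficient
    -- is an error of order `0`.
    set B := A.filter (fun i => M i < m ∧ ∀ i' ∈ A, i < i' → ¬ M i' < m) with hB
    have e4 : ∑ i ∈ broken s t U A, a i ≤ err t a d 1 A :=
      sum_le_err broken_subset (image_broken_mem_fam hx.le hx.lt (mem_fam_one.2 hU) A)
    have hB1 : B.card ≤ 1 := by
      refine Finset.card_le_one.2 fun i hi i' hi' => ?_
      obtain ⟨h1, h2, h3⟩ := Finset.mem_filter.1 hi
      obtain ⟨k1, k2, k3⟩ := Finset.mem_filter.1 hi'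
      rcases lt_trichotomy i i' with hlt | he | hlt
      · exact absurd k2 (h3 i' k1 hlt)
      · exact he
      · exact absurd h2 (k3 i h1 hlt)
    have e5 : ∑ i ∈ B, a i ≤ err t a d 1 A := by
      refine sum_le_err (Finset.filter_subset _ _)
        (mem_fam_one.2 (schreier_mono (Nat.zero_le d) ?_))
      exact Finset.card_image_le.trans hB1
    have hrest : ∀ i ∈ A, i ∉ broken s t U A → i ∉ B → Θ * θ q * cellSum θ G (x i) ≤ D := by
      intro i hi hiU hiB
      have hc0 := cellSum_nonneg (θ := θ) G (x i)
      by_cases hmM : m ≤ M i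
      · obtain ⟨H, hH, hle⟩ := hUi i fun hb => hiU (mem_broken.2 ⟨hi, hb⟩)
        calc Θ * θ q * cellSum θ G (x i) ≤ C * rootLim θ ^ m * cellSum θ H (x i) := by gcongr
          _ = C * (rootLim θ ^ m * cellSum θ H (x i)) := mul_assoc _ _ _
          _ ≤ C * (1 + η) := mul_le_mul_of_nonneg_left (hgood i m hmM H hH) hC
          _ ≤ D := by rw [hD, mul_comm]; linarith
      · have : ∃ i' ∈ A, i < i' ∧ M i' < m := by
          by_contra! hcon
          exact hiB (Finset.mem_filter.2 ⟨hi, not_le.1 hmM, fun i' hi' hlt =>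
            not_lt.2 (hcon i' hi' hlt)⟩)
        obtain ⟨i', -, hlt, hm'⟩ := this
        calc Θ * θ q * cellSum θ G (x i) ≤ 1 * θ q * (t i : ℕ) := by
              gcongr
              exact hx.cellSum_le_coe h G i
          _ = θ q * (t i : ℕ) := by rw [one_mul]
          _ ≤ η := hM i i' hlt q (by omega)
          _ ≤ D := by rw [hD]; nlinarith
    have e6 : ∑ i ∈ broken s t G A, a i * (Θ * θ q * cellSum θ G (x i)) ≤
        D * ∑ i ∈ broken s t G A, a i + (∑ i ∈ broken s t U A, a i + ∑ i ∈ B, a i) := by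
      have h1 : ∀ i ∈ broken s t G A, a i * (Θ * θ q * cellSum θ G (x i)) ≤
          D * a i + ((if i ∈ broken s t U A then a i else 0) + if i ∈ B then a i else 0) := by
        intro i hi
        have hDa : 0 ≤ D * a i := mul_nonneg hD0 (ha i)
        have h2 := mul_le_of_le_one_right (ha i) (hval i)
        have h3 := ha i
        by_cases hiU : i ∈ broken s t U A
        · rw [if_pos hiU]
          split_ifs <;> linarith
        · by_cases hiB : i ∈ B
          · rw [if_pos hiB, if_neg hiU]
            linarith
          · rw [if_neg hiU, if_neg hiB, add_zero, add_zero, mul_comm D]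
            exact mul_le_mul_of_nonneg_left (hrest i (broken_subset hi) hiU hiB) h3
      refine (Finset.sum_le_sum h1).trans ?_
      rw [Finset.sum_add_distrib, Finset.sum_add_distrib, ← Finset.mul_sum, ← Finset.sum_filter,
        ← Finset.sum_filter]
      refine add_le_add le_rfl (add_le_add ?_ ?_) <;>
        exact Finset.sum_le_sum_of_subset_of_nonneg (fun i hi => (Finset.mem_filter.1 hi).2)
          fun i _ _ => ha i
    have e7 : ∑ g ∈ G, Θ * θ q * nrm θ (comb a x (inCell s t G A g)) ≤
        D * ∑ g ∈ G, ∑ i ∈ inCell s t G A g, a i := by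
      rw [Finset.mul_sum]
      refine Finset.sum_le_sum fun g _ => ?_
      exact mul_le_mul (hθC'.trans hCD) (hx.nrm_comb_le h ha _) (nrm_nonneg _) hD0
    have e8 := mul_le_mul_of_nonneg_left e3 hD0
    rw [mul_add] at e8
    have e9 : 0 ≤ (d : ℝ) * err t a d 1 A := by positivity
    rw [hR]
    linarith

end IsNormalizedBlock

/-! ### Block bases -/

/-- A finitely supported sequence as an element of the normed space `C00`. -/
def toC00 (θ : ℕ+ → ℝ) (h : IsRegular θ) (x : ℕ+ →₀ ℝ) : C00 θ h := x

theorem linearCombination_e (θ : ℕ+ → ℝ) (h : IsRegular θ) (x : ℕ+ →₀ ℝ) :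
    Finsupp.linearCombination ℝ (e θ h) x = (toC00 θ h x : UniformSpace.Completion (C00 θ h)) := by
  induction x using Finsupp.induction_linear with
  | zero => rw [map_zero]; exact (UniformSpace.Completion.coe_zero).symm
  | add x y hx hy =>
    rw [map_add, hx, hy]
    exact (UniformSpace.Completion.coe_add (toC00 θ h x) (toC00 θ h y)).symm
  | single k r =>
    have h1 : toC00 θ h (Finsupp.single k r) = r • toC00 θ h (Finsupp.single k 1) :=
      (Finsupp.smul_single_one k r).symm
    rw [Finsupp.linearCombination_single, h1, UniformSpace.Completion.coe_smul]
    rfl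

theorem norm_linearCombination_e (θ : ℕ+ → ℝ) (h : IsRegular θ) (x : ℕ+ →₀ ℝ) :
    ‖Finsupp.linearCombination ℝ (e θ h) x‖ = nrm θ x := by
  rw [linearCombination_e, UniformSpace.Completion.norm_coe]
  rfl

theorem mem_ran_of_mem_support {x : ℕ+ →₀ ℝ} {k : ℕ+} (hk : k ∈ x.support) : k ∈ ran x :=
  ⟨k, hk, k, hk, le_rfl, le_rfl⟩

section Block

variable {v : ℕ+ → ℕ+ →₀ ℝ}

/-- Links the two coordinate systems: far out with respect to `(y_i)` implies far out with respect
to `(e_k)`. -/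
theorem le_of_mem_ran (hv : ∀ i, v i ≠ 0)
    (hlt : ∀ i j, i < j → ∀ a ∈ ran (v i), ∀ b ∈ ran (v j), a < b) (k : ℕ+) :
    ∀ l ∈ ran (v k), k ≤ l := by
  induction k using PNat.recOn with
  | one => exact fun l _ => one_le
  | succ k ih =>
    intro l hl
    obtain ⟨a, ha⟩ := Finsupp.support_nonempty_iff.2 (hv k)
    have ha := mem_ran_of_mem_support ha
    have hal := hlt k (k + 1) (PNat.lt_add_right k 1) a ha l hl
    exact PNat.add_one_le_iff.2 ((ih a ha).trans_lt hal)

/-- `exists_small_cellSum` is applied with `n = τ` to the normalized tail of the block basis beyond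
`τ`, and the resulting vector is rescaled. Coefficients `d` and vector are both supported beyond
`τ`. -/
theorem exists_normalized_good {θ : ℕ+ → ℝ} (h : IsRegular θ) (hv : ∀ i, v i ≠ 0)
    (hlt : ∀ i j, i < j → ∀ a ∈ ran (v i), ∀ b ∈ ran (v j), a < b) (τ : ℕ+) (M : ℕ) {ρ : ℝ}
    (hρ : 1 < ρ) :
    ∃ d : ℕ+ →₀ ℝ, d ≠ 0 ∧ (∀ k ∈ d.support, τ ≤ k) ∧
      (∀ k ∈ (Finsupp.linearCombination ℝ v d).support, τ ≤ k) ∧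
      nrm θ (Finsupp.linearCombination ℝ v d) = 1 ∧
      ∀ m ≤ M, ∀ H ∈ Fam m τ,
        rootLim θ ^ m * cellSum θ H (Finsupp.linearCombination ℝ v d) ≤ ρ := by
  have hne : ∀ i : ℕ, (v (τ + i.succPNat)).support.Nonempty := fun i =>
    Finsupp.support_nonempty_iff.2 (hv _)
  have hpos : ∀ i : ℕ, 0 < nrm θ (v (τ + i.succPNat)) := fun i => nrm_pos h (hv _)
  have hx : IsNormalizedBlock θ
      (fun i => (nrm θ (v (τ + i.succPNat)))⁻¹ • v (τ + i.succPNat))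
      (fun i => (v (τ + i.succPNat)).support.min' (hne i))
      (fun i => (v (τ + i.succPNat)).support.max' (hne i)) := by
    refine ⟨fun i => Finset.min'_le_max' _ _, fun i => ?_, fun i k hk => ?_, fun i => ?_⟩
    · refine hlt (τ + i.succPNat) (τ + (i + 1).succPNat) ?_ _
        (mem_ran_of_mem_support (Finset.max'_mem _ _)) _
        (mem_ran_of_mem_support (Finset.min'_mem _ _))
      rw [← PNat.coe_lt_coe]
      simp
    · have hk := Finsupp.support_smul hk
      exact ⟨Finset.min'_le _ _ hk, Finset.le_max' _ _ hk⟩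
    · rw [nrm_smul, abs_of_pos (inv_pos.2 (hpos i)), inv_mul_cancel₀ (hpos i).ne']
  obtain ⟨A, a, ⟨i₀, hi₀⟩, hapos, hgood⟩ := hx.exists_small_cellSum h τ.pos M hρ
  set x := fun i : ℕ => (nrm θ (v (τ + i.succPNat)))⁻¹ • v (τ + i.succPNat) with hxdef
  set N := nrm θ (comb a x A) with hN
  have hN0 : 0 < N := by
    have h1 : nrm θ (comb a x {i₀}) ≤ N := by
      rw [← hx.restrict_comb a (Finset.singleton_subset_iff.2 hi₀)]
      exact nrm_restrict_le h _ _
    refine lt_of_lt_of_le ?_ h1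
    rw [comb, Finset.sum_singleton, nrm_smul, hx.nrm_eq, mul_one]
    exact abs_pos.2 (hapos i₀ hi₀).ne'
  set d : ℕ+ →₀ ℝ := N⁻¹ • ∑ i ∈ A, Finsupp.single (τ + i.succPNat)
    (a i * (nrm θ (v (τ + i.succPNat)))⁻¹) with hd
  have hw : Finsupp.linearCombination ℝ v d = N⁻¹ • comb a x A := by
    rw [hd, map_smul, map_sum, comb]
    congr 1
    refine Finset.sum_congr rfl fun i _ => ?_
    rw [Finsupp.linearCombination_single, hxdef, smul_smul]
  have hw1 : nrm θ (Finsupp.linearCombination ℝ v d) = 1 := by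
    rw [hw, nrm_smul, abs_of_pos (inv_pos.2 hN0), inv_mul_cancel₀ hN0.ne']
  have hdτ : ∀ k ∈ d.support, τ ≤ k := by
    intro k hk
    have hk := Finsupp.support_finsetSum (Finsupp.support_smul hk)
    obtain ⟨i, -, hi⟩ := Finset.mem_biUnion.1 hk
    have hi := Finsupp.support_single_subset hi
    rw [Finset.mem_singleton] at hi
    rw [hi]
    exact (PNat.lt_add_right _ _).le
  refine ⟨d, ?_, hdτ, ?_, hw1, ?_⟩
  · intro h0
    rw [h0, map_zero, nrm_zero] at hw1
    exact zero_ne_one hw1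
  · intro k hk
    rw [Finsupp.linearCombination_apply, Finsupp.sum] at hk
    obtain ⟨i, hi, hk⟩ := Finset.mem_biUnion.1 (Finsupp.support_finsetSum hk)
    exact (hdτ i hi).trans
      (le_of_mem_ran hv hlt i k (mem_ran_of_mem_support (Finsupp.support_smul hk)))
  · intro m hm H hH
    rw [hw, cellSum_smul, abs_of_pos (inv_pos.2 hN0)]
    calc rootLim θ ^ m * (N⁻¹ * cellSum θ H (comb a x A))
        = N⁻¹ * (rootLim θ ^ m * cellSum θ H (comb a x A)) := by ring
      _ ≤ N⁻¹ * (ρ * N) := by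
        have := hgood m hm H hH
        gcongr
      _ = ρ := by field_simp

/-- Recursive choice: `M i` depends only on `s i` and makes `θ_q s_i ≤ η` for `q ≥ M i`; then the
vector is chosen, and `t i` bounds its support. Since `t i < s i'` for `i < i'`, the last property
follows. The same `s`, `t` enclose the supports in both coordinate systems, so admissibility in `Y`
and norm estimates in `X` use the same index sets. -/
theorem exists_good_sequence {θ : ℕ+ → ℝ} (h : IsRegular θ) (hv : ∀ i, v i ≠ 0)
    (hlt : ∀ i j, i < j → ∀ a ∈ ran (v i), ∀ b ∈ ran (v j), a < b) {η : ℝ} (hη : 0 < η) :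
    ∃ (d : ℕ → ℕ+ →₀ ℝ) (s t : ℕ → ℕ+) (M : ℕ → ℕ), (∀ i, d i ≠ 0) ∧
      (∀ i, ∀ k ∈ (d i).support, s i ≤ k ∧ k ≤ t i) ∧
      IsNormalizedBlock θ (fun i => Finsupp.linearCombination ℝ v (d i)) s t ∧
      (∀ i, ∀ m ≤ M i, ∀ H ∈ Fam m (s i),
        rootLim θ ^ m * cellSum θ H (Finsupp.linearCombination ℝ v (d i)) ≤ 1 + η) ∧
      ∀ i i', i < i' → ∀ q : ℕ+, M i' ≤ q → θ q * (t i : ℕ) ≤ η := by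
  have hM : ∀ τ : ℕ+, ∃ M : ℕ, ∀ q : ℕ+, M ≤ q → θ q * (τ : ℕ) ≤ η := by
    intro τ
    have h1 := h.tendsto_zero.mul_const ((τ : ℕ) : ℝ)
    rw [zero_mul] at h1
    obtain ⟨Q, hQ⟩ := eventually_atTop.1 (h1.eventually (gt_mem_nhds hη))
    exact ⟨Q, fun q hq => (hQ q hq).le⟩
  choose M hM using hM
  choose D hD0 hDτ hDw hDn hDg using fun τ : ℕ+ =>
    exists_normalized_good h hv hlt τ (M τ) (by linarith : 1 < 1 + η)
  have hT : ∀ τ : ℕ+, ∃ T : ℕ+, τ ≤ T ∧ (∀ k ∈ (D τ).support, k ≤ T) ∧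
      ∀ k ∈ (Finsupp.linearCombination ℝ v (D τ)).support, k ≤ T := by
    intro τ
    obtain ⟨T, hT⟩ := (insert τ ((D τ).support ∪
      (Finsupp.linearCombination ℝ v (D τ)).support)).bddAbove
    simp only [Finset.coe_insert, Finset.coe_union] at hT
    exact ⟨T, hT (Or.inl rfl), fun k hk => hT (Or.inr (Or.inl hk)),
      fun k hk => hT (Or.inr (Or.inr hk))⟩
  choose T hT1 hT2 hT3 using hT
  let s : ℕ → ℕ+ := fun i => Nat.rec 1 (fun _ τ => T τ + 1) i
  have hs : ∀ i, s (i + 1) = T (s i) + 1 := fun i => rfl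
  have hb : IsNormalizedBlock θ (fun i => Finsupp.linearCombination ℝ v (D (s i))) s
      (fun i => T (s i)) :=
    ⟨fun i => hT1 _, fun i => by rw [hs]; exact PNat.lt_add_right _ _,
      fun i k hk => ⟨hDw _ k hk, hT3 _ k hk⟩, fun i => hDn _⟩
  refine ⟨fun i => D (s i), s, fun i => T (s i), fun i => M (s i), fun i => hD0 _,
    fun i k hk => ⟨hDτ _ k hk, hT2 _ k hk⟩, hb, fun i => hDg _, fun i i' hii q hq => ?_⟩
  refine le_trans ?_ (hM (s i') q hq)
  have := (lt_of_interlaced hb.le hb.lt hii).le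
  have hq := h.pos q
  gcongr
  exact_mod_cast this

/-- A set of successive blocks whose index set is controlled by a Schreier set is admissible. -/
theorem admissible_ran {d : ℕ → ℕ+ →₀ ℝ} {s t : ℕ → ℕ+} (hst : ∀ i, s i ≤ t i)
    (hts : ∀ i, t i < s (i + 1)) (hd : ∀ i, d i ≠ 0)
    (hsupp : ∀ i, ∀ k ∈ (d i).support, s i ≤ k ∧ k ≤ t i) {r n : ℕ} {F : Finset ℕ}
    (hF : F.image s ∈ Schreier r) {f : Fin n → ℕ} (hf : StrictMono f) (hfF : ∀ i, f i ∈ F)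
    {c : Fin n → ℕ+ →₀ ℝ} (hc : ∀ i, (c i).support = (d (f i)).support) :
    Admissible r (fun i => ran (c i)) := by
  have hne : ∀ i, (d i).support.Nonempty := fun i => Finsupp.support_nonempty_iff.2 (hd i)
  have hran : ∀ i, ∀ z ∈ ran (c i), s (f i) ≤ z ∧ z ≤ t (f i) := by
    rintro i z ⟨a, ha, b, hb, haz, hzb⟩
    rw [hc] at ha hb
    exact ⟨(hsupp _ a ha).1.trans haz, hzb.trans (hsupp _ b hb).2⟩
  refine ⟨fun i j hij a ha b hb => ?_, fun i => (d (f i)).support.min' (hne _), fun i => ?_, ?_⟩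
  · exact ((hran i a ha).2.trans_lt (lt_of_interlaced hst hts (hf hij))).trans_le (hran j b hb).1
  · refine ⟨mem_ran_of_mem_support (by rw [hc]; exact Finset.min'_mem _ _), ?_⟩
    rintro z ⟨a, ha, -, -, haz, -⟩
    rw [hc] at ha
    exact (Finset.min'_le _ a ha).trans haz
  · set k : ℕ → ℕ+ := fun i => (d i).support.min' (hne i) with hk
    have hks : ∀ i, s i ≤ k i ∧ k i ≤ t i := fun i => hsupp i _ (Finset.min'_mem _ _)
    have hkm : StrictMono k := strictMono_nat_of_lt_succ fun i =>
      ((hks i).2.trans_lt (hts i)).trans_le (hks (i + 1)).1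
    have hinv : ∀ i, Function.invFun k (k i) = i := Function.leftInverse_invFun hkm.injective
    refine mem_schreier_of_map (fun z => s (Function.invFun k z)) hF ?_ ?_ ?_
    · intro x hx y hy hxy
      obtain ⟨i, -, rfl⟩ := Finset.mem_image.1 hx
      obtain ⟨i', -, rfl⟩ := Finset.mem_image.1 hy
      change s (Function.invFun k (k (f i))) < s (Function.invFun k (k (f i')))
      rw [hinv, hinv]
      exact (strictMono_of_interlaced hst hts).1 (hkm.lt_iff_lt.1 hxy)
    · intro x hx
      obtain ⟨i, -, rfl⟩ := Finset.mem_image.1 hx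
      change s (Function.invFun k (k (f i))) ∈ _
      rw [hinv]
      exact Finset.mem_image_of_mem s (hfF i)
    · intro x hx
      obtain ⟨i, -, rfl⟩ := Finset.mem_image.1 hx
      change s (Function.invFun k (k (f i))) ≤ k (f i)
      rw [hinv]
      exact (hks _).1

end Block

/-- The upper estimate for `δ_j` by the first of the two terms. -/
theorem delta_le {θ : ℕ+ → ℝ} (h : IsRegular θ) {y : ℕ+ → Space θ h}
    (hy : IsBlockBasis y (e θ h)) (j : ℕ+) :
    delta j y ≤ rootLim θ ^ (j : ℕ) * ⨆ p : Set.Ici j, phi θ p := by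
  obtain ⟨v, hv, hlt, hyv⟩ := hy
  have hr := rootLim_pos h
  set C := rootLim θ ^ (j : ℕ) * ⨆ p : Set.Ici j, phi θ p with hC
  have hθC : ∀ (p : ℕ+) (m : ℕ), (p : ℕ) = j + m → θ p ≤ C * rootLim θ ^ m := by
    intro p m hp
    have hbdd : BddAbove (Set.range fun p : Set.Ici j => phi θ p) :=
      ⟨1, by rintro _ ⟨p, rfl⟩; exact phi_le_one h _⟩
    have hjp : j ≤ p := by
      rw [← PNat.coe_le_coe]
      omega
    have h1 : phi θ p ≤ ⨆ p : Set.Ici j, phi θ p :=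
      le_ciSup hbdd (⟨p, hjp⟩ : Set.Ici j)
    rw [phi, div_le_iff₀ (by positivity), hp, pow_add] at h1
    rw [hC]
    linarith
  have hC0 : 0 ≤ C := by
    have := hθC j 0 rfl
    rw [pow_zero, mul_one] at this
    exact (h.pos j).le.trans this
  have hnorm : ∀ d : ℕ+ →₀ ℝ, ‖Finsupp.linearCombination ℝ y d‖ =
      nrm θ (Finsupp.linearCombination ℝ v d) := by
    intro d
    rw [← norm_linearCombination_e θ h, Finsupp.apply_linearCombination]
    congr 2
    exact congrArg _ (funext hyv)
  refine csSup_le ⟨0, le_rfl, fun n c _ => by simp⟩ ?_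
  rintro δ ⟨-, hδ⟩
  by_contra! hlt'
  -- The norm of the average will be at most `(1 + η) C + η + (j + 1) η = C + (C + j + 2) η`, which
  -- is strictly below `C + (C + j + 3) η = δ`.
  set η := (δ - C) / (C + j + 3) with hη
  have hη0 : 0 < η := div_pos (by linarith) (by positivity)
  have hηeq : η * (C + j + 3) = δ - C := div_mul_cancel₀ _ (by positivity)
  obtain ⟨d, s, t, M, hd0, hds, hb, hgood, hM⟩ := exists_good_sequence h hv hlt hη0
  obtain ⟨F, a, -, ha, hapos, -, hsum, hF, hsmall⟩ := exists_average hb.le hb.lt j hη0 0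
  -- The recursion starts with nothing split: `l = 0`, `Θ = 1` and `d = j - 1`.
  have hupper := hb.mul_nrm_comb_le h ha hη0.le hC0 hgood hM hθC (j - 1) 0
    (by have := j.pos; omega) 1 one_pos le_rfl
    (fun q p hp => by
      rw [zero_add] at hp
      rw [one_mul, PNat.coe_injective hp]) F
  have herr : err t a (j - 1) 1 F ≤ η := by
    obtain ⟨B, -, b2, b3⟩ := exists_eq_err t a (j - 1) 1 F
    rw [b3]
    exact hsmall _ (by have := j.pos; omega) B (mem_fam_one.1 b2)
  have hj1 : ((j - 1 : ℕ) : ℝ) + 2 = j + 1 := by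
    have : ((j - 1 : ℕ) : ℝ) + 1 = j := by
      have := j.pos
      exact_mod_cast (by omega : (j : ℕ) - 1 + 1 = j)
    linarith
  rw [one_mul, hsum, mul_one, hj1] at hupper
  have hlower := hδ F.card (fun i => a (F.orderEmbOfFin rfl i) • d (F.orderEmbOfFin rfl i))
    (admissible_ran hb.le hb.lt hd0 hds hF (F.orderEmbOfFin rfl).strictMono
      (F.orderEmbOfFin_mem rfl)
      fun i => Finsupp.support_smul_eq (hapos _ (F.orderEmbOfFin_mem rfl i)).ne')
  have hre : ∀ {N : Type} [AddCommMonoid N] (g : ℕ → N),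
      ∑ i : Fin F.card, g (F.orderEmbOfFin rfl i) = ∑ i ∈ F, g i := by
    intro N _ g
    conv_rhs => rw [← Finset.image_orderEmbOfFin_univ F rfl]
    rw [Finset.sum_image fun i _ j _ hij => (F.orderEmbOfFin rfl).injective hij]
  rw [← map_sum, hnorm, hre (fun i => a i • d i), map_sum] at hlower
  simp only [hnorm] at hlower
  rw [hre (fun i => nrm θ (Finsupp.linearCombination ℝ v (a i • d i)))] at hlower
  simp only [map_smul, nrm_smul, hb.nrm_eq, mul_one, abs_of_nonneg (ha _), hsum] at hlower
  change δ ≤ nrm θ (comb a (fun i => Finsupp.linearCombination ℝ v (d i)) F) at hlower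
  have h1 : ((j : ℝ) + 1) * err t a (j - 1) 1 F ≤ (j + 1) * η := by gcongr
  nlinarith

end MixedTsirelson

theorem theoremT (θ : ℕ+ → ℝ) (h : MixedTsirelson.IsRegular θ)
    (y : ℕ+ → MixedTsirelson.Space θ h)
    (hy : MixedTsirelson.IsBlockBasis y (MixedTsirelson.e θ h)) (j : ℕ+) :
    MixedTsirelson.delta j y ≤
      max (MixedTsirelson.rootLim θ ^ (j : ℕ) * ⨆ p : Set.Ici j, MixedTsirelson.phi θ p)
        (θ j / θ 1) :=
  (MixedTsirelson.delta_le h hy j).trans (le_max_left _ _)
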